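/- Let $d_1\ge 1$ be an integer and let $s>0$ be a real number. For $\mu>0$ and $R>0$ let $E_1(\mu,R)$ denote the first (smallest) eigenvalue of the Schrödinger operator $-\Delta+\mu|x|^{2s}$ on the ball $B(0,R)=\{x\in\mathbb{R}^{d_1}:|x|<R\}$ with Dirichlet boundary conditions, understood weakly: $E_1(\mu,R)$ is the smallest $E\in\mathbb{R}$ for which there is $u\in H^1_0(B(0,R))$, $u\neq 0$, with $$\int_{B(0,R)}\big(\nabla u\cdot\nabla w+\mu|x|^{2s}uw\big)\,dx=E\int_{B(0,R)}uw\,dx\qquad\text{for all } w\in H^1_0(B(0,R)).$$ Here $H^1_0(B(0,R))$ is the closure of $C_c^\infty(B(0,R))$ in $H^1(B(0,R))$, and all functions are real-valued. Then, for all $R>0$ and $\mu>0$, the smallest eigenvalue $E_1(\mu,R)$ exists, the function $E_1(\cdot,R)$ is twice differentiable on $(0,+\infty)$, and $$s\,\frac{\partial E_1}{\partial\mu}(\mu,R)+\mu(1+s)\,\frac{\partial^2 E_1}{\partial\mu^2}(\mu,R)\ \ge\ 0 .$$ -/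

import Mathlib

open MeasureTheory Filter Topology
open scoped ContDiff

noncomputable section

namespace Schrodinger

/-- A test function on `Ω`: an element of `C_c^∞(Ω)`, extended by zero to the whole space. -/
structure IsTestFunction {d : ℕ} (Ω : Set (EuclideanSpace ℝ (Fin d)))
    (φ : EuclideanSpace ℝ (Fin d) → ℝ) : Prop where
  smooth : ContDiff ℝ ∞ φ
  hasCompactSupport : HasCompactSupport φ
  tsupport_subset : tsupport φ ⊆ Ω

/-- `g` is the weak gradient of `u` on `Ω`: `∫_Ω u ∇φ = - ∫_Ω φ g` for all `φ ∈ C_c^∞(Ω)`. -/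
def IsWeakGradient {d : ℕ} (Ω : Set (EuclideanSpace ℝ (Fin d)))
    (u : EuclideanSpace ℝ (Fin d) → ℝ)
    (g : EuclideanSpace ℝ (Fin d) → EuclideanSpace ℝ (Fin d)) : Prop :=
  ∀ φ : EuclideanSpace ℝ (Fin d) → ℝ, IsTestFunction Ω φ →
    ∫ x in Ω, u x • gradient φ x = -∫ x in Ω, φ x • g x

/-- `u ∈ H¹(Ω)`, with weak gradient `g`. -/
structure MemH1 {d : ℕ} (Ω : Set (EuclideanSpace ℝ (Fin d)))
    (u : EuclideanSpace ℝ (Fin d) → ℝ)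
    (g : EuclideanSpace ℝ (Fin d) → EuclideanSpace ℝ (Fin d)) : Prop where
  memLp : MemLp u 2 (volume.restrict Ω)
  memLp_grad : MemLp g 2 (volume.restrict Ω)
  isWeakGradient : IsWeakGradient Ω u g

/-- `u ∈ H¹₀(Ω)`, with weak gradient `g`: `u` lies in `H¹(Ω)` and is a limit, in the norm
`(‖u‖₂² + ‖∇u‖₂²)^{1/2}` of `H¹(Ω)`, of functions in `C_c^∞(Ω)`. -/
structure MemH10 {d : ℕ} (Ω : Set (EuclideanSpace ℝ (Fin d)))
    (u : EuclideanSpace ℝ (Fin d) → ℝ)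
    (g : EuclideanSpace ℝ (Fin d) → EuclideanSpace ℝ (Fin d)) : Prop extends MemH1 Ω u g where
  exists_approx : ∃ φ : ℕ → EuclideanSpace ℝ (Fin d) → ℝ,
    (∀ n, IsTestFunction Ω (φ n)) ∧
    Tendsto (fun n => eLpNorm (fun x => φ n x - u x) 2 (volume.restrict Ω)) atTop (𝓝 0) ∧
    Tendsto (fun n => eLpNorm (fun x => gradient (φ n) x - g x) 2 (volume.restrict Ω))
      atTop (𝓝 0)

/-- `E` is an eigenvalue of `-Δ + V` on `Ω` with Dirichlet boundary conditions, in the weak sense: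
there is a nonzero `u ∈ H¹₀(Ω)` such that
`∫_Ω ∇u · ∇w + V u w = E ∫_Ω u w` for all `w ∈ H¹₀(Ω)`.
(For `V` bounded and measurable on `Ω` all these integrals converge.) -/
def IsDirichletEigenvalue {d : ℕ} (Ω : Set (EuclideanSpace ℝ (Fin d)))
    (V : EuclideanSpace ℝ (Fin d) → ℝ) (E : ℝ) : Prop :=
  ∃ (u : EuclideanSpace ℝ (Fin d) → ℝ)
    (g : EuclideanSpace ℝ (Fin d) → EuclideanSpace ℝ (Fin d)),
    MemH10 Ω u g ∧ ¬ (u =ᵐ[volume.restrict Ω] 0) ∧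
    ∀ (w : EuclideanSpace ℝ (Fin d) → ℝ)
      (h : EuclideanSpace ℝ (Fin d) → EuclideanSpace ℝ (Fin d)), MemH10 Ω w h →
      ∫ x in Ω, (inner ℝ (g x) (h x) + V x * u x * w x) = E * ∫ x in Ω, u x * w x

/-- The set of Dirichlet eigenvalues of `-Δ + μ|x|^{2s}` on the ball `B(0,R)` of `ℝ^d`. -/
def ballEigenvalues (d : ℕ) (s μ R : ℝ) : Set ℝ :=
  {E | IsDirichletEigenvalue (Metric.ball (0 : EuclideanSpace ℝ (Fin d)) R)
    (fun x => μ * ‖x‖ ^ (2 * s)) E}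

/-- The first (least) Dirichlet eigenvalue `E₁(μ,R)` of `-Δ + μ|x|^{2s}` on the ball `B(0,R)`
of `ℝ^d`. -/
def E₁ (d : ℕ) (s μ R : ℝ) : ℝ := sInf (ballEigenvalues d s μ R)

end Schrodinger

end

/-! The inequality says that μ^{s/(1+s)} ∂E₁/∂μ is nondecreasing in μ, and ∂E₁/∂μ is the mean P(μ)
of |x|^{2s} in the ground state (Feynman–Hellmann). What has to be shown is therefore c^{2s} P(μ₁) ≤
P(μ₂) whenever 0 < c < 1 and c^{2+2s} μ₂ = μ₁.

Let u and w be the radial ground states for μ₁ and μ₂. The dilated function v(ρ) = w(cρ) lives on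
the larger ball of radius R/c, and its potential differs from that of u by a constant only. The
Wronskian identity then makes v/u nondecreasing on [0,R) (`IsRadialSolution.monotoneOn_div`), so on
[0,R] the weight v² gives ρ^{2s} a mean at least P(μ₁) (`integral_sub_mul_nonneg`). The rest of v,
on [R,R/c], only sees values ρ^{2s} ≥ R^{2s} > P(μ₁). Undoing the dilation gives
`mul_groundMoment_le`.

The ground state itself comes from the radial equation, written as u = 1 + Ku with K linear in (μ,E)
and quasinilpotent; hence u is differentiable in (μ,E). A solution positive on [0,R) and zero at R
yields the least eigenvalue by Picone's identity (`IsRadialSolution.isLeast`), and one exists by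
shooting in E (`exists_isGroundPair`). The Wronskian of two ground states expresses the difference
quotients of E₁ exactly, which gives E₁' = P (`hasDerivAt_E₁`); P is differentiable because u is. -/

noncomputable section

namespace Schrodinger

section
open Set
open scoped BoundedContinuousFunction

/-! ### The radial Volterra operator -/

/-- The weighted mean `∫₀¹ σ^{d-1} g(tσ) dσ`; for `t > 0` it equals `t^{-d} ∫₀ᵗ τ^{d-1} g(τ) dτ`. -/
def radialMean (d : ℕ) (g : ℝ → ℝ) (t : ℝ) : ℝ := ∫ σ in (0 : ℝ)..1, σ ^ (d - 1) * g (t * σ)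

/-- Integrating over the fixed interval [0,1] removes the singularity of the radial equation: at t =
0 nothing is divided by t. -/
theorem continuous_radialMean (d : ℕ) {g : ℝ → ℝ} (hg : Continuous g) :
    Continuous (radialMean d g) := by
  unfold radialMean
  apply intervalIntegral.continuous_parametric_intervalIntegral_of_continuous'
  unfold Function.uncurry
  fun_prop

theorem pow_mul_radialMean {d : ℕ} (hd : 1 ≤ d) (g : ℝ → ℝ) (t : ℝ) :
    t ^ d * radialMean d g t = ∫ τ in (0 : ℝ)..t, τ ^ (d - 1) * g τ := by
  have h := intervalIntegral.mul_integral_comp_mul_left (a := 0) (b := 1)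
    (f := fun τ => τ ^ (d - 1) * g τ) t
  rw [mul_zero, mul_one] at h
  rw [← h, radialMean]
  obtain ⟨k, rfl⟩ : ∃ k, d = k + 1 := ⟨d - 1, by omega⟩
  simp only [Nat.add_sub_cancel, mul_pow, mul_assoc, intervalIntegral.integral_const_mul]
  ring

/-- This is t N' + d N = g. If u' = tF then u'' + (d-1)u'/t = tF' + dF, so F = N(qu) is the radial
equation in first-order form. -/
theorem hasDerivAt_radialMean {d : ℕ} (hd : 1 ≤ d) {g : ℝ → ℝ} (hg : Continuous g) {t : ℝ}
    (ht : 0 < t) :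
    HasDerivAt (radialMean d g) ((g t - d * radialMean d g t) / t) t := by
  have hc : Continuous fun τ : ℝ => τ ^ (d - 1) * g τ := by fun_prop
  have h1 : HasDerivAt (fun r => ∫ τ in (0 : ℝ)..r, τ ^ (d - 1) * g τ) (t ^ (d - 1) * g t) t :=
    intervalIntegral.integral_hasDerivAt_right (hc.intervalIntegrable _ _)
      (hc.stronglyMeasurableAtFilter _ _) hc.continuousAt
  have h2 := h1.div (hasDerivAt_pow d t) (pow_pos ht d).ne'
  have h3 : radialMean d g =ᶠ[𝓝 t]
      (fun r => ∫ τ in (0 : ℝ)..r, τ ^ (d - 1) * g τ) / fun r => r ^ d := by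
    filter_upwards [lt_mem_nhds ht] with r hr
    have : r ^ d ≠ 0 := (pow_pos hr d).ne'
    rw [Pi.div_apply, ← pow_mul_radialMean hd]
    field_simp
  refine (h2.congr_of_eventuallyEq h3).congr_deriv ?_
  rw [← pow_mul_radialMean hd]
  obtain ⟨k, rfl⟩ : ∃ k, d = k + 1 := ⟨d - 1, by omega⟩
  simp only [Nat.add_sub_cancel]
  have : t ≠ 0 := ht.ne'
  field_simp
  ring

theorem abs_radialMean_le (d : ℕ) {g : ℝ → ℝ} {t B : ℝ}
    (h : ∀ σ ∈ Ioc (0 : ℝ) 1, |g (t * σ)| ≤ B) : |radialMean d g t| ≤ B := by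
  have := intervalIntegral.norm_integral_le_of_norm_le_const (a := 0) (b := 1) (C := B)
    (f := fun σ : ℝ => σ ^ (d - 1) * g (t * σ)) ?_
  · simpa [radialMean] using this
  · intro σ hσ
    rw [uIoc_of_le zero_le_one] at hσ
    rw [norm_mul, Real.norm_eq_abs, Real.norm_eq_abs, abs_of_nonneg (pow_nonneg hσ.1.le _)]
    have h1 : σ ^ (d - 1) ≤ 1 := pow_le_one₀ hσ.1.le hσ.2
    calc σ ^ (d - 1) * |g (t * σ)| ≤ 1 * |g (t * σ)| := by gcongr
      _ ≤ B := by rw [one_mul]; exact h σ hσ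

/-- The projection of the line onto `[-L, L]`. -/
def clamp (L ρ : ℝ) : ℝ := max (-L) (min ρ L)

theorem continuous_clamp (L : ℝ) : Continuous (clamp L) := by unfold clamp; fun_prop

theorem clamp_of_abs_le {L ρ : ℝ} (h : |ρ| ≤ L) : clamp L ρ = ρ := by
  rw [abs_le] at h
  rw [clamp, min_eq_left h.2, max_eq_right h.1]

theorem abs_clamp_le {L : ℝ} (hL : 0 ≤ L) (ρ : ℝ) : |clamp L ρ| ≤ L := by
  rw [abs_le, clamp]
  exact ⟨le_max_left _ _, max_le (by linarith) (min_le_right _ _)⟩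

/-- The function `ρ ↦ ∫₀^ρ t N(g)(t) dt`, with `N` the radial mean, frozen outside `[-L, L]`. -/
def radialPrimitive (d : ℕ) (L : ℝ) (g : ℝ → ℝ) (ρ : ℝ) : ℝ :=
  ∫ t in (0 : ℝ)..clamp L ρ, t * radialMean d g t

theorem continuous_radialPrimitive (d : ℕ) (L : ℝ) {g : ℝ → ℝ} (hg : Continuous g) :
    Continuous (radialPrimitive d L g) := by
  have h : Continuous fun t => t * radialMean d g t :=
    continuous_id.mul (continuous_radialMean d hg)
  exact (intervalIntegral.continuous_primitive (fun a b => h.intervalIntegrable a b) 0).comp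
    (continuous_clamp L)

/-- One application raises the power of |ρ| by one and divides by n + 1, the kernel factor t being
absorbed in L. Iteration produces the 1/n! that makes the operator quasinilpotent. -/
theorem abs_radialPrimitive_le (d : ℕ) {L : ℝ} (hL : 0 ≤ L) {g : ℝ → ℝ} (hg : Continuous g)
    {B : ℝ} (n : ℕ) (h : ∀ t, |t| ≤ L → |g t| ≤ B * |t| ^ n) (ρ : ℝ) :
    |radialPrimitive d L g ρ| ≤ L * B * (|clamp L ρ| ^ (n + 1) / (n + 1)) := by
  rcases hL.eq_or_lt with rfl | hL'
  · have : clamp 0 ρ = 0 := by simpa using abs_clamp_le le_rfl ρ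
    simp [radialPrimitive, this]
  have hB : 0 ≤ B := by
    have := (abs_nonneg _).trans (h L (abs_of_pos hL').le)
    rw [abs_of_pos hL'] at this
    exact nonneg_of_mul_nonneg_left this (pow_pos hL' n)
  have hc : Continuous fun t => t * radialMean d g t :=
    continuous_id.mul (continuous_radialMean d hg)
  calc |radialPrimitive d L g ρ|
      ≤ ∫ t in uIoc 0 (clamp L ρ), ‖t * radialMean d g t‖ :=
        by
          rw [radialPrimitive, ← Real.norm_eq_abs]
          exact intervalIntegral.norm_integral_le_integral_norm_uIoc
    _ ≤ ∫ t in uIoc 0 (clamp L ρ), L * B * |t - 0| ^ n := by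
        have hi : ∀ f : ℝ → ℝ, Continuous f → IntegrableOn f (uIoc 0 (clamp L ρ)) := fun f hf =>
          intervalIntegrable_iff.1 (hf.intervalIntegrable _ _)
        refine setIntegral_mono_on (hi _ hc.norm) (hi _ (by fun_prop)) measurableSet_uIoc ?_
        intro t ht
        have htL : |t| ≤ L := by
          have h1 : t ∈ uIcc 0 (clamp L ρ) := uIoc_subset_uIcc ht
          have h2 := abs_sub_left_of_mem_uIcc h1
          simpa using h2.trans (by simpa using abs_clamp_le hL ρ)
        rw [norm_mul, Real.norm_eq_abs, Real.norm_eq_abs, sub_zero, mul_assoc]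
        refine mul_le_mul htL ?_ (abs_nonneg _) hL
        refine abs_radialMean_le d fun σ hσ => ?_
        have h3 : |t * σ| ≤ |t| := by
          rw [abs_mul, abs_of_pos hσ.1]
          exact mul_le_of_le_one_right (abs_nonneg _) hσ.2
        exact (h _ (h3.trans htL)).trans (by gcongr)
    _ = _ := by
        rw [integral_const_mul, integral_pow_abs_sub_uIoc, sub_zero]

theorem radialPrimitive_linear (d : ℕ) (L : ℝ) {g h : ℝ → ℝ} (hg : Continuous g)
    (hh : Continuous h) (b c ρ : ℝ) :
    radialPrimitive d L (fun t => b * g t + c * h t) ρ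
      = b * radialPrimitive d L g ρ + c * radialPrimitive d L h ρ := by
  have hc : ∀ (c : ℝ) {f : ℝ → ℝ}, Continuous f →
      Continuous fun t => c * (t * radialMean d f t) := fun c f hf =>
    continuous_const.mul (continuous_id.mul (continuous_radialMean d hf))
  rw [radialPrimitive, radialPrimitive, radialPrimitive, ← intervalIntegral.integral_const_mul,
    ← intervalIntegral.integral_const_mul, ← intervalIntegral.integral_add
    ((hc b hg).intervalIntegrable _ _) ((hc c hh).intervalIntegrable _ _)]
  congr 1
  ext t
  have : radialMean d (fun t => b * g t + c * h t) t
      = b * radialMean d g t + c * radialMean d h t := by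
    rw [radialMean, radialMean, radialMean, ← intervalIntegral.integral_const_mul,
      ← intervalIntegral.integral_const_mul, ← intervalIntegral.integral_add]
    · congr 1
      ext σ
      ring
    · exact Continuous.intervalIntegrable (by fun_prop) _ _
    · exact Continuous.intervalIntegrable (by fun_prop) _ _
  rw [this]
  ring

/-- The operator `f ↦ radialPrimitive (a f)` on bounded continuous functions. -/
def radialOp (d : ℕ) (L : ℝ) (hL : 0 ≤ L) (a : C(ℝ, ℝ)) : (ℝ →ᵇ ℝ) →L[ℝ] (ℝ →ᵇ ℝ) :=
  have hb : ∃ M, ∀ f : ℝ →ᵇ ℝ, ∀ ρ,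
      ‖radialPrimitive d L (fun τ => a τ * f τ) ρ‖ ≤ M * ‖f‖ := by
    obtain ⟨M, hM⟩ := (isCompact_Icc (a := -L) (b := L)).exists_bound_of_continuousOn
      a.continuous.continuousOn
    refine ⟨L * M * L, fun f ρ => ?_⟩
    have h := abs_radialPrimitive_le d hL (a.continuous.mul f.continuous) (B := M * ‖f‖) 0
      (fun t ht => ?_) ρ
    · have hM0 : 0 ≤ M := (norm_nonneg _).trans (hM 0 ⟨by simpa using hL, hL⟩)
      simp only [Nat.cast_zero, zero_add, pow_one, div_one] at h
      calc _ ≤ _ := h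
        _ ≤ L * (M * ‖f‖) * L := by
          have := abs_clamp_le hL ρ
          gcongr
        _ = _ := by ring
    · rw [pow_zero, mul_one, Pi.mul_apply, abs_mul]
      exact mul_le_mul (hM t (abs_le.1 ht)) (f.norm_coe_le_norm t) (abs_nonneg _)
        ((norm_nonneg _).trans (hM t (abs_le.1 ht)))
  LinearMap.mkContinuousOfExistsBound
    { toFun := fun f => BoundedContinuousFunction.ofNormedAddCommGroup
        (radialPrimitive d L fun τ => a τ * f τ)
        (continuous_radialPrimitive d L (a.continuous.mul f.continuous))
        (hb.choose * ‖f‖) (hb.choose_spec f)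
      map_add' := by
        intro f g
        ext ρ
        change radialPrimitive d L _ ρ = radialPrimitive d L _ ρ + radialPrimitive d L _ ρ
        have h := radialPrimitive_linear d L (a.continuous.mul f.continuous)
          (a.continuous.mul g.continuous) 1 1 ρ
        rw [one_mul, one_mul] at h
        refine Eq.trans ?_ h
        congr 1
        ext t
        simp
        ring
      map_smul' := by
        intro c f
        ext ρ
        change radialPrimitive d L _ ρ = c * radialPrimitive d L _ ρ
        have h := radialPrimitive_linear d L (a.continuous.mul f.continuous)
          (a.continuous.mul f.continuous) c 0 ρ
        rw [zero_mul, add_zero] at h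
        refine Eq.trans ?_ h
        congr 1
        ext t
        simp
        ring }
    (by
      obtain ⟨M, hM⟩ := hb
      refine ⟨max M 0, fun f => ?_⟩
      refine (BoundedContinuousFunction.norm_le (by positivity)).2 fun ρ => ?_
      exact (hM f ρ).trans (by gcongr; exact le_max_left _ _))

theorem radialOp_apply (d : ℕ) {L : ℝ} (hL : 0 ≤ L) (a : C(ℝ, ℝ)) (f : ℝ →ᵇ ℝ) (ρ : ℝ) :
    radialOp d L hL a f ρ = radialPrimitive d L (fun τ => a τ * f τ) ρ := rfl

theorem isUnit_one_sub_radialOp (d : ℕ) {L : ℝ} (hL : 0 ≤ L) (a : C(ℝ, ℝ)) :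
    IsUnit (1 - radialOp d L hL a) := by
  obtain ⟨M, hM⟩ := (isCompact_Icc (a := -L) (b := L)).exists_bound_of_continuousOn
    a.continuous.continuousOn
  have hM0 : 0 ≤ M := (norm_nonneg _).trans (hM 0 ⟨by simpa using hL, hL⟩)
  set T := radialOp d L hL a with hT
  have key : ∀ (n : ℕ) (f : ℝ →ᵇ ℝ) (ρ : ℝ), |(T ^ n) f ρ|
      ≤ (L * M) ^ n * ‖f‖ / n.factorial * |clamp L ρ| ^ n := by
    intro n
    induction n with
    | zero => intro f ρ; simpa using f.norm_coe_le_norm ρ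
    | succ n ih =>
      intro f ρ
      rw [pow_succ', mul_apply_eq_comp, hT, radialOp_apply, ← hT]
      refine (abs_radialPrimitive_le d hL (a.continuous.mul ((T ^ n) f).continuous)
        (B := M * ((L * M) ^ n * ‖f‖ / n.factorial)) n (fun t ht => ?_) ρ).trans (le_of_eq ?_)
      · rw [Pi.mul_apply, abs_mul, mul_assoc M]
        refine mul_le_mul (hM t (abs_le.1 ht)) ?_ (abs_nonneg _) hM0
        simpa [clamp_of_abs_le ht] using ih f t
      · rw [Nat.factorial_succ]
        push_cast
        field_simp
        ring
  have hlim := FloorSemiring.tendsto_pow_div_factorial_atTop (L * M * L)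
  obtain ⟨n, hn⟩ := (hlim.eventually (gt_mem_nhds (zero_lt_one (α := ℝ)))).exists
  have hnorm : ‖T ^ n‖ < 1 := by
    refine lt_of_le_of_lt (ContinuousLinearMap.opNorm_le_bound _ (by positivity) fun f => ?_) hn
    refine (BoundedContinuousFunction.norm_le (by positivity)).2 fun ρ => ?_
    refine (key n f ρ).trans ?_
    have := abs_clamp_le hL ρ
    calc (L * M) ^ n * ‖f‖ / n.factorial * |clamp L ρ| ^ n
        ≤ (L * M) ^ n * ‖f‖ / n.factorial * L ^ n := by gcongr
      _ = _ := by rw [mul_pow (L * M)]; ring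
  -- 1 - Tⁿ is invertible and is the product of 1 - T with the geometric sum; the factors commute,
  -- so 1 - T is invertible too.
  have hu := isUnit_one_sub_of_norm_lt_one (R := (ℝ →ᵇ ℝ) →L[ℝ] (ℝ →ᵇ ℝ)) hnorm
  rw [← mul_neg_geom_sum] at hu
  refine ((Commute.isUnit_mul_iff ?_).1 hu).1
  rw [Commute, SemiconjBy, mul_neg_geom_sum, geom_sum_mul_neg]

end

/-! ### The radial initial value problem, its dependence on (μ, E), and the Wronskian. -/

section
open Set
open scoped BoundedContinuousFunction

/-- `u` solves the radial equation `u'' + (d-1)/ρ u' = q u` on `(0, L)` with `u(0) = 1`, and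
`u'(ρ) = ρ F(ρ)` with `F` continuous. -/
structure IsRadialSolution (d : ℕ) (L : ℝ) (q u F : ℝ → ℝ) : Prop where
  continuous_u : Continuous u
  continuous_F : Continuous F
  u_zero : u 0 = 1
  hasDerivAt_u : ∀ ρ, |ρ| < L → HasDerivAt u (ρ * F ρ) ρ
  -- No bound ρ < L here: the F constructed below is a radial mean, for which the equation holds
  -- beyond L as well.
  hasDerivAt_F : ∀ ρ, 0 < ρ → HasDerivAt F ((q ρ * u ρ - d * F ρ) / ρ) ρ

/-- The radial part of `-Δ + μ|x|^{2s} - E`. -/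
def radialPotential (s μ E ρ : ℝ) : ℝ := μ * ρ ^ (2 * s) - E

theorem continuous_radialPotential {s : ℝ} (hs : 0 < s) (μ E : ℝ) :
    Continuous (radialPotential s μ E) := by
  have := Real.continuous_rpow_const (q := 2 * s) (by positivity)
  unfold radialPotential
  fun_prop

/-- The weight `ρ ^ {2s}` as a continuous map. -/
def powMap {s : ℝ} (hs : 0 < s) : C(ℝ, ℝ) :=
  ⟨fun ρ => ρ ^ (2 * s), Real.continuous_rpow_const (by positivity)⟩

/-- The operator whose fixed-point equation `u = 1 + K u` is the radial equation. -/
def volterraOp (d : ℕ) {s L : ℝ} (hs : 0 < s) (hL : 0 ≤ L) (p : ℝ × ℝ) :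
    (ℝ →ᵇ ℝ) →L[ℝ] (ℝ →ᵇ ℝ) :=
  p.1 • radialOp d L hL (powMap hs) - p.2 • radialOp d L hL 1

theorem volterraOp_eq (d : ℕ) {s L : ℝ} (hs : 0 < s) (hL : 0 ≤ L) (p : ℝ × ℝ) :
    volterraOp d hs hL p =
      radialOp d L hL ⟨radialPotential s p.1 p.2, continuous_radialPotential hs _ _⟩ := by
  ext f ρ
  have h := radialPrimitive_linear d L ((powMap hs).continuous.mul f.continuous)
    ((1 : C(ℝ, ℝ)).continuous.mul f.continuous) p.1 (-p.2) ρ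
  simp only [volterraOp, sub_apply, smul_apply,
    BoundedContinuousFunction.coe_sub, BoundedContinuousFunction.coe_smul, Pi.sub_apply,
    radialOp_apply, smul_eq_mul]
  have h2 : (fun τ => (⟨radialPotential s p.1 p.2, continuous_radialPotential hs _ _⟩ :
      C(ℝ, ℝ)) τ * f τ) = fun t => p.1 * (powMap hs t * f t) + -p.2 * ((1 : C(ℝ, ℝ)) t * f t) := by
    ext t
    simp [radialPotential, powMap]
    ring
  rw [h2]
  refine Eq.trans ?_ h.symm
  rw [neg_mul, ← sub_eq_add_neg]
  rfl

/-- The solution of the radial equation with parameters `p = (μ, E)`. -/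
def radialSolution (d : ℕ) {s L : ℝ} (hs : 0 < s) (hL : 0 ≤ L) (p : ℝ × ℝ) : ℝ →ᵇ ℝ :=
  Ring.inverse (1 - volterraOp d hs hL p) 1

/-- Inversion is smooth at units and its argument is affine in the two parameters. -/
theorem differentiable_inverse_one_sub {A : Type*} [NormedRing A] [NormedAlgebra ℝ A]
    [HasSummableGeomSeries A] {X : Type*} [NormedAddCommGroup X]
    [NormedSpace ℝ X] (φ : A →L[ℝ] X) (a b : A)
    (h : ∀ p : ℝ × ℝ, IsUnit (1 - (p.1 • a - p.2 • b))) :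
    Differentiable ℝ fun p : ℝ × ℝ => φ (Ring.inverse (1 - (p.1 • a - p.2 • b))) := by
  intro p
  obtain ⟨U, hU⟩ := h p
  have h1 : DifferentiableAt ℝ (Ring.inverse : A → A) (1 - (p.1 • a - p.2 • b)) := by
    rw [← hU]
    exact (contDiffAt_ringInverse ℝ (n := 1) U).differentiableAt one_ne_zero
  have h2 : DifferentiableAt ℝ (fun p : ℝ × ℝ => 1 - (p.1 • a - p.2 • b)) p := by fun_prop
  have h3 := DifferentiableAt.comp p h1 h2
  exact φ.differentiableAt.comp p h3

theorem differentiable_radialSolution (d : ℕ) {s L : ℝ} (hs : 0 < s) (hL : 0 ≤ L) :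
    Differentiable ℝ (radialSolution d hs hL) := by
  exact differentiable_inverse_one_sub (A := (ℝ →ᵇ ℝ) →L[ℝ] (ℝ →ᵇ ℝ))
    (ContinuousLinearMap.apply ℝ (ℝ →ᵇ ℝ) (1 : ℝ →ᵇ ℝ))
    (radialOp d L hL (powMap hs)) (radialOp d L hL 1) fun p => by
      have := isUnit_one_sub_radialOp d hL
        ⟨radialPotential s p.1 p.2, continuous_radialPotential hs _ _⟩
      rwa [← volterraOp_eq] at this

/-- The function `F` with `u'(ρ) = ρ F(ρ)`. -/
def radialSlope (d : ℕ) {s L : ℝ} (hs : 0 < s) (hL : 0 ≤ L) (p : ℝ × ℝ) : ℝ → ℝ :=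
  radialMean d fun τ => radialPotential s p.1 p.2 τ * radialSolution d hs hL p τ

theorem radialSolution_eq (d : ℕ) {s L : ℝ} (hs : 0 < s) (hL : 0 ≤ L) (p : ℝ × ℝ) (ρ : ℝ) :
    radialSolution d hs hL p ρ
      = 1 + ∫ t in (0 : ℝ)..clamp L ρ, t * radialSlope d hs hL p t := by
  have hu : IsUnit (1 - volterraOp d hs hL p) := by
    rw [volterraOp_eq]
    exact isUnit_one_sub_radialOp d hL _
  have h := congrArg (fun T => T (1 : ℝ →ᵇ ℝ)) (Ring.mul_inverse_cancel _ hu)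
  have h2 : radialSolution d hs hL p - volterraOp d hs hL p (radialSolution d hs hL p) = 1 := h
  rw [sub_eq_iff_eq_add, volterraOp_eq] at h2
  exact congrArg (fun f : ℝ →ᵇ ℝ => f ρ) h2

theorem isRadialSolution_radialSolution {d : ℕ} (hd : 1 ≤ d) {s L : ℝ} (hs : 0 < s)
    (hL : 0 ≤ L) (μ E : ℝ) :
    IsRadialSolution d L (radialPotential s μ E) (radialSolution d hs hL (μ, E))
      (radialSlope d hs hL (μ, E)) := by
  have hc : Continuous fun τ => radialPotential s μ E τ * radialSolution d hs hL (μ, E) τ :=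
    (continuous_radialPotential hs μ E).mul (radialSolution d hs hL (μ, E)).continuous
  have hF : Continuous (radialSlope d hs hL (μ, E)) := continuous_radialMean d hc
  refine ⟨(radialSolution d hs hL (μ, E)).continuous, hF, ?_, fun ρ hρ => ?_, fun ρ hρ =>
    hasDerivAt_radialMean hd hc hρ⟩
  · rw [radialSolution_eq, clamp_of_abs_le (by simpa using hL)]
    simp
  · have hc2 : Continuous fun t => t * radialSlope d hs hL (μ, E) t := continuous_id.mul hF
    have h1 : HasDerivAt (fun r => 1 + ∫ t in (0 : ℝ)..r, t * radialSlope d hs hL (μ, E) t)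
        (ρ * radialSlope d hs hL (μ, E) ρ) ρ :=
      (intervalIntegral.integral_hasDerivAt_right (hc2.intervalIntegrable _ _)
        (hc2.stronglyMeasurableAtFilter _ _) hc2.continuousAt).const_add 1
    refine h1.congr_of_eventuallyEq ?_
    filter_upwards [continuous_abs.continuousAt.eventually (gt_mem_nhds hρ)] with r hr
    rw [radialSolution_eq, clamp_of_abs_le hr.le]

namespace IsRadialSolution

/-- The trivial solution; its Wronskian with another solution gives `pow_mul_F`. -/
theorem one (d : ℕ) (L : ℝ) : IsRadialSolution d L 0 1 0 where
  continuous_u := continuous_const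
  continuous_F := continuous_const
  u_zero := rfl
  hasDerivAt_u ρ _ := (hasDerivAt_const ρ (1 : ℝ)).congr_deriv (by simp)
  hasDerivAt_F ρ _ := (hasDerivAt_const ρ (0 : ℝ)).congr_deriv (by simp)

variable {d : ℕ} {L : ℝ} {q u F q₁ q₂ u₁ u₂ F₁ F₂ : ℝ → ℝ}

theorem mono (h : IsRadialSolution d L q u F) {L' : ℝ} (hL : L' ≤ L) :
    IsRadialSolution d L' q u F :=
  { h with hasDerivAt_u := fun ρ hρ => h.hasDerivAt_u ρ (hρ.trans_le hL) }

/-- For the potential μρ^{2s} - E with ρ ≥ 0, the dilation replaces (μ, E) by (c^{2+2s}μ, c²E). -/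
theorem comp_mul (h : IsRadialSolution d L q u F) {c : ℝ} (hc : 0 < c) :
    IsRadialSolution d (L / c) (fun ρ => c ^ 2 * q (c * ρ)) (fun ρ => u (c * ρ))
      (fun ρ => c ^ 2 * F (c * ρ)) where
  continuous_u := h.continuous_u.comp (continuous_const.mul continuous_id)
  continuous_F := continuous_const.mul (h.continuous_F.comp (continuous_const.mul continuous_id))
  u_zero := by simpa using h.u_zero
  hasDerivAt_u ρ hρ := by
    have hm : HasDerivAt (fun ρ : ℝ => c * ρ) c ρ := by simpa using (hasDerivAt_id ρ).const_mul c
    have h1 : |c * ρ| < L := by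
      rw [abs_mul, abs_of_pos hc, mul_comm]
      exact (lt_div_iff₀ hc).1 hρ
    exact ((h.hasDerivAt_u _ h1).comp ρ hm).congr_deriv (by ring)
  hasDerivAt_F ρ hρ := by
    have hm : HasDerivAt (fun ρ : ℝ => c * ρ) c ρ := by simpa using (hasDerivAt_id ρ).const_mul c
    have h1 := ((h.hasDerivAt_F _ (mul_pos hc hρ)).comp ρ hm).const_mul (c ^ 2)
    refine h1.congr_deriv ?_
    field_simp

/-- The Wronskian (Lagrange) identity. -/
theorem wronskian (h₁ : IsRadialSolution d L q₁ u₁ F₁) (h₂ : IsRadialSolution d L q₂ u₂ F₂)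
    (hd : 1 ≤ d) (hq₁ : Continuous q₁) (hq₂ : Continuous q₂) {r : ℝ} (hr : 0 ≤ r) (hrL : r < L) :
    r ^ d * (F₁ r * u₂ r - u₁ r * F₂ r)
      = ∫ ρ in (0 : ℝ)..r, ρ ^ (d - 1) * ((q₁ ρ - q₂ ρ) * (u₁ ρ * u₂ ρ)) := by
  have c1 := h₁.continuous_u
  have c2 := h₂.continuous_u
  have c3 := h₁.continuous_F
  have c4 := h₂.continuous_F
  obtain ⟨k, rfl⟩ : ∃ k, d = k + 1 := ⟨d - 1, by omega⟩
  -- Since r^d F = r^{d-1} u', this is the usual weighted Wronskian; on differentiation the terms in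
  -- F₁F₂ cancel.
  rw [intervalIntegral.integral_eq_sub_of_hasDerivAt_of_le
    (f := fun r => r ^ (k + 1) * (F₁ r * u₂ r - u₁ r * F₂ r)) hr]
  · simp
  · exact Continuous.continuousOn (by fun_prop)
  · intro ρ hρ
    have hρL : |ρ| < L := by rw [abs_of_pos hρ.1]; exact hρ.2.trans hrL
    refine ((hasDerivAt_pow (k + 1) ρ).mul
      (((h₁.hasDerivAt_F ρ hρ.1).mul (h₂.hasDerivAt_u ρ hρL)).sub
        ((h₁.hasDerivAt_u ρ hρL).mul (h₂.hasDerivAt_F ρ hρ.1)))).congr_deriv ?_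
    have := hρ.1.ne'
    simp only [Nat.add_sub_cancel, Pi.mul_apply, Pi.sub_apply]
    field_simp
    ring
  · exact Continuous.intervalIntegrable (by fun_prop) _ _

theorem pow_mul_F (h : IsRadialSolution d L q u F) (hd : 1 ≤ d) (hq : Continuous q) {r : ℝ}
    (hr : 0 ≤ r) (hrL : r < L) :
    r ^ d * F r = ∫ ρ in (0 : ℝ)..r, ρ ^ (d - 1) * (q ρ * u ρ) := by
  simpa using h.wronskian (one d L) hd hq continuous_zero hr hrL

end IsRadialSolution

end

/-! ### From the radial equation to its weak form on ℝ^d. -/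

section
open Set Asymptotics
open scoped BoundedContinuousFunction

variable {d : ℕ} {L : ℝ} {q u F : ℝ → ℝ}

/-- Writing f' as ‖x‖a covers the origin, where the norm is not differentiable: there f' = 0 and
f(‖x‖) - f(0) = o(‖x‖). -/
theorem hasFDerivAt_comp_norm {E : Type*} [NormedAddCommGroup E] [InnerProductSpace ℝ E]
    {f : ℝ → ℝ} {a : ℝ} {x : E} (h : HasDerivAt f (‖x‖ * a) ‖x‖) :
    HasFDerivAt (fun x => f ‖x‖) (a • innerSL ℝ x) x := by
  rcases eq_or_ne x 0 with rfl | hx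
  · simp only [map_zero, smul_zero]
    rw [norm_zero, zero_mul] at h
    have h1 := h.hasFDerivAt.isLittleO
    refine .of_isLittleO ?_
    have h2 : Tendsto (fun x : E => ‖x‖) (𝓝 0) (𝓝 0) := by
      simpa using (continuous_norm (E := E)).tendsto 0
    have h3 : (fun x : E => f ‖x‖ - f 0) =o[𝓝 0] fun x : E => ‖x‖ := by
      simpa [Function.comp_def] using h1.comp_tendsto h2
    simpa using h3.of_norm_right
  · have h1 := (hasStrictFDerivAt_norm_sq x).hasFDerivAt.sqrt (by simpa using hx)
    have h2 : HasFDerivAt (fun x : E => ‖x‖) (‖x‖⁻¹ • innerSL ℝ x) x := by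
      refine (h1.congr_of_eventuallyEq (.of_forall fun y => ?_)).congr_fderiv ?_
      · simp
      · ext y
        have := norm_ne_zero_iff.2 hx
        simp
        field_simp
    refine (h.comp_hasFDerivAt x h2).congr_fderiv ?_
    have := norm_ne_zero_iff.2 hx
    rw [smul_smul]
    congr 1
    field_simp

/-- These are the components of ∇u = F(‖x‖)x. At the origin continuity of F is enough, because the
factor xᵢ vanishes there. -/
theorem hasFDerivAt_norm_mul_coord (h : IsRadialSolution d L q u F) (i : Fin d)
    (x : EuclideanSpace ℝ (Fin d)) :
    HasFDerivAt (fun x : EuclideanSpace ℝ (Fin d) => F ‖x‖ * x i)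
      (F ‖x‖ • (EuclideanSpace.proj i : EuclideanSpace ℝ (Fin d) →L[ℝ] ℝ)
        + (x i * ((q ‖x‖ * u ‖x‖ - d * F ‖x‖) / ‖x‖ ^ 2)) • innerSL ℝ x) x := by
  have hp : HasFDerivAt (fun x : EuclideanSpace ℝ (Fin d) => x i)
      (EuclideanSpace.proj i : EuclideanSpace ℝ (Fin d) →L[ℝ] ℝ) x :=
    (EuclideanSpace.proj i : EuclideanSpace ℝ (Fin d) →L[ℝ] ℝ).hasFDerivAt
  rcases eq_or_ne x 0 with rfl | hx
  · refine .of_isLittleO ?_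
    have h1 : (fun y : EuclideanSpace ℝ (Fin d) => F ‖y‖ - F 0) =o[𝓝 0] fun _ => (1 : ℝ) := by
      rw [isLittleO_one_iff]
      have : Continuous fun y : EuclideanSpace ℝ (Fin d) => F ‖y‖ - F 0 :=
        (h.continuous_F.comp continuous_norm).sub continuous_const
      simpa using this.tendsto 0
    have h2 : (fun y : EuclideanSpace ℝ (Fin d) => y i) =O[𝓝 0] fun y => y :=
      (EuclideanSpace.proj i : EuclideanSpace ℝ (Fin d) →L[ℝ] ℝ).isBigO_id _
    have h3 := h1.mul_isBigO h2.norm_right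
    simp only [one_mul] at h3
    refine (h3.of_norm_right).congr (fun y => ?_) (fun y => by simp)
    simp
    ring
  · have hn : 0 < ‖x‖ := norm_pos_iff.2 hx
    have h1 : HasFDerivAt (fun x : EuclideanSpace ℝ (Fin d) => F ‖x‖)
        (((q ‖x‖ * u ‖x‖ - d * F ‖x‖) / ‖x‖ ^ 2) • innerSL ℝ x) x :=
      hasFDerivAt_comp_norm ((h.hasDerivAt_F _ hn).congr_deriv (by field_simp))
    refine (h1.mul hp).congr_fderiv ?_
    rw [smul_smul]

theorem sum_coord_smul_single (x : EuclideanSpace ℝ (Fin d)) :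
    ∑ i, x i • EuclideanSpace.single i (1 : ℝ) = x := by
  ext j
  simp [Finset.sum_apply, Pi.single_apply]

theorem continuous_fderiv_apply_self {w : EuclideanSpace ℝ (Fin d) → ℝ} (hw : ContDiff ℝ 1 w) :
    Continuous fun x => fderiv ℝ w x x :=
  (hw.continuous_fderiv one_ne_zero).clm_apply continuous_id

/-- The weak form of the radial equation on the whole space. -/
theorem IsRadialSolution.integral_fderiv (h : IsRadialSolution d L q u F) (hd : 1 ≤ d)
    (hq : Continuous q) {w : EuclideanSpace ℝ (Fin d) → ℝ} (hw : ContDiff ℝ 1 w)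
    (hwc : HasCompactSupport w) :
    ∫ x, (F ‖x‖ * fderiv ℝ w x x + q ‖x‖ * u ‖x‖ * w x) = 0 := by
  have : Nonempty (Fin d) := ⟨⟨0, hd⟩⟩
  have hFn : Continuous fun x : EuclideanSpace ℝ (Fin d) => F ‖x‖ :=
    h.continuous_F.comp continuous_norm
  have hun : Continuous fun x : EuclideanSpace ℝ (Fin d) => u ‖x‖ :=
    h.continuous_u.comp continuous_norm
  have hqn : Continuous fun x : EuclideanSpace ℝ (Fin d) => q ‖x‖ := hq.comp continuous_norm
  have hdw : ∀ v, Continuous fun x => fderiv ℝ w x v := fun v =>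
    (hw.continuous_fderiv one_ne_zero).clm_apply continuous_const
  set G : Fin d → EuclideanSpace ℝ (Fin d) → ℝ := fun i x => F ‖x‖ * x i with hG
  have hGc : ∀ i, Continuous (G i) := fun i =>
    hFn.mul (EuclideanSpace.proj i : EuclideanSpace ℝ (Fin d) →L[ℝ] ℝ).continuous
  have hfd : ∀ i x, fderiv ℝ (G i) x (EuclideanSpace.single i 1)
      = F ‖x‖ + x i ^ 2 * ((q ‖x‖ * u ‖x‖ - d * F ‖x‖) / ‖x‖ ^ 2) := by
    intro i x
    rw [(hasFDerivAt_norm_mul_coord h i x).fderiv]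
    simp [EuclideanSpace.inner_single_right]
    ring
  have hI1 : ∀ i, Integrable fun x => fderiv ℝ w x (EuclideanSpace.single i 1) * G i x :=
    fun i => ((hdw _).mul (hGc i)).integrable_of_hasCompactSupport
      ((hwc.fderiv_apply (𝕜 := ℝ) _).mul_right)
  have hI2 : ∀ i, Integrable fun x => w x * fderiv ℝ (G i) x (EuclideanSpace.single i 1) := by
    intro i
    -- The bound xᵢ²/‖x‖² ≤ 1 dominates ∂ᵢGᵢ by continuous functions, so the division by ‖x‖² does
    -- no harm.
    have hdom : Integrable fun x => |w x| * (|F ‖x‖| + |q ‖x‖ * u ‖x‖ - d * F ‖x‖|) := by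
      refine Continuous.integrable_of_hasCompactSupport ?_ (HasCompactSupport.mul_right ?_)
      · exact hw.continuous.abs.mul (hFn.abs.add
          ((hqn.mul hun).sub (continuous_const.mul hFn)).abs)
      · exact hwc.abs
    refine hdom.mono' (hw.continuous.aestronglyMeasurable.mul
      (measurable_fderiv_apply_const ℝ _ _).aestronglyMeasurable) (.of_forall fun x => ?_)
    rw [norm_mul, Real.norm_eq_abs, Real.norm_eq_abs, hfd]
    refine mul_le_mul_of_nonneg_left ((abs_add_le _ _).trans ?_) (abs_nonneg _)
    refine add_le_add le_rfl ?_
    rcases eq_or_ne x 0 with rfl | hx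
    · simp
    have hn : 0 < ‖x‖ ^ 2 := by positivity
    rw [abs_mul, abs_div, abs_of_pos hn, abs_of_nonneg (sq_nonneg _), ← mul_div_assoc,
      div_le_iff₀ hn, mul_comm]
    refine mul_le_mul_of_nonneg_left ?_ (abs_nonneg _)
    rw [← sq_abs]
    exact pow_le_pow_left₀ (abs_nonneg _) (PiLp.norm_apply_le x i) 2
  have hI3 : ∀ i, Integrable fun x => w x * G i x := fun i =>
    (hw.continuous.mul (hGc i)).integrable_of_hasCompactSupport hwc.mul_right
  have hibp : ∀ i, ∫ x, (fderiv ℝ w x (EuclideanSpace.single i 1) * G i x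
      + w x * fderiv ℝ (G i) x (EuclideanSpace.single i 1)) = 0 := by
    intro i
    rw [integral_add (hI1 i) (hI2 i), integral_mul_fderiv_eq_neg_fderiv_mul_of_integrable
      (hI1 i) (hI2 i) (hI3 i) (fun x _ => (hw.differentiable one_ne_zero) x)
      (fun x _ => (hasFDerivAt_norm_mul_coord h i x).differentiableAt), add_neg_cancel]
  have hsum := Finset.sum_eq_zero fun i (_ : i ∈ Finset.univ) => hibp i
  rw [← integral_finsetSum (f := fun i x => fderiv ℝ w x (EuclideanSpace.single i 1) * G i x
      + w x * fderiv ℝ (G i) x (EuclideanSpace.single i 1)) _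
      fun i _ => (hI1 i).add (hI2 i)] at hsum
  rw [← hsum]
  refine integral_congr_ae ?_
  have h0 : ∀ᵐ x : EuclideanSpace ℝ (Fin d), x ≠ 0 := by
    rw [ae_iff]
    simp
  filter_upwards [h0] with x hx
  have hn : ‖x‖ ^ 2 ≠ 0 := by positivity
  simp only [Finset.sum_add_distrib, hfd]
  have e1 : ∑ i, fderiv ℝ w x (EuclideanSpace.single i 1) * G i x = F ‖x‖ * fderiv ℝ w x x := by
    conv_rhs => rw [← sum_coord_smul_single x, map_sum, Finset.mul_sum]
    refine Finset.sum_congr rfl fun i _ => ?_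
    rw [sum_coord_smul_single, map_smul, smul_eq_mul]
    simp only [hG]
    ring
  -- Hence the divergence of F(‖x‖)x is dF + (qu - dF) = qu away from the origin.
  have e2 : ∑ i, x i ^ 2 = ‖x‖ ^ 2 := by
    rw [EuclideanSpace.norm_sq_eq]
    simp
  rw [e1, ← Finset.mul_sum, Finset.sum_add_distrib, ← Finset.sum_mul, e2]
  simp only [Finset.sum_const, Finset.card_univ, Fintype.card_fin, nsmul_eq_mul]
  field_simp
  ring

end

/-! ### Picone's identity for positive radial solutions. -/

section
open Set Asymptotics Metric
open scoped BoundedContinuousFunction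

variable {d : ℕ} {L R : ℝ} {q u F : ℝ → ℝ}

theorem continuous_gradient {φ : EuclideanSpace ℝ (Fin d) → ℝ} (hφ : ContDiff ℝ 1 φ) :
    Continuous (gradient φ) :=
  (InnerProductSpace.toDual ℝ _).symm.continuous.comp (hφ.continuous_fderiv one_ne_zero)

theorem gradient_eq_zero_of_notMem_tsupport {φ : EuclideanSpace ℝ (Fin d) → ℝ}
    {x : EuclideanSpace ℝ (Fin d)} (hx : x ∉ tsupport φ) : gradient φ x = 0 := by
  rw [gradient, fderiv_of_notMem_tsupport ℝ hx]
  exact map_zero _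

theorem HasCompactSupport.gradient {φ : EuclideanSpace ℝ (Fin d) → ℝ}
    (hφ : HasCompactSupport φ) : HasCompactSupport (gradient φ) :=
  hφ.mono' fun x hx => by
    by_contra h
    exact hx (gradient_eq_zero_of_notMem_tsupport h)

theorem IsRadialSolution.hasFDerivAt (h : IsRadialSolution d L q u F)
    {x : EuclideanSpace ℝ (Fin d)} (hx : ‖x‖ < L) :
    HasFDerivAt (fun x : EuclideanSpace ℝ (Fin d) => u ‖x‖) (F ‖x‖ • innerSL ℝ x) x :=
  hasFDerivAt_comp_norm (h.hasDerivAt_u _ (by rwa [abs_norm]))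

theorem IsRadialSolution.contDiffAt (h : IsRadialSolution d L q u F)
    {x : EuclideanSpace ℝ (Fin d)} (hx : ‖x‖ < L) :
    ContDiffAt ℝ 1 (fun x : EuclideanSpace ℝ (Fin d) => u ‖x‖) x := by
  rw [contDiffAt_one_iff]
  refine ⟨fun x => F ‖x‖ • innerSL ℝ x, ball 0 L, isOpen_ball.mem_nhds (by simpa using hx),
    ?_, fun y hy => h.hasFDerivAt (by simpa using hy)⟩
  exact ((h.continuous_F.comp continuous_norm).smul (innerSL ℝ).continuous).continuousOn

/-- A positive radial solution gives a lower bound for the quadratic form (Picone's identity). -/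
theorem IsRadialSolution.integral_nonneg (h : IsRadialSolution d L q u F) (hd : 1 ≤ d)
    (hq : Continuous q) (hRL : R ≤ L) (hpos : ∀ ρ, 0 ≤ ρ → ρ < R → 0 < u ρ)
    {φ : EuclideanSpace ℝ (Fin d) → ℝ} (hφ : ContDiff ℝ 1 φ) (hφc : HasCompactSupport φ)
    (hφs : tsupport φ ⊆ ball 0 R) :
    0 ≤ ∫ x, (‖gradient φ x‖ ^ 2 + q ‖x‖ * φ x ^ 2) := by
  have hun : ∀ x : EuclideanSpace ℝ (Fin d), x ∈ ball 0 R → 0 < u ‖x‖ := fun x hx =>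
    hpos _ (norm_nonneg _) (by simpa using hx)
  have hxL : ∀ x : EuclideanSpace ℝ (Fin d), x ∈ ball 0 R → ‖x‖ < L := fun x hx =>
    lt_of_lt_of_le (by simpa using hx) hRL
  -- φ²/u is the test function for the weak equation; it is C¹ because u > 0 on the support of φ.
  set w : EuclideanSpace ℝ (Fin d) → ℝ := fun x => φ x ^ 2 / u ‖x‖ with hw
  have hws : tsupport w ⊆ tsupport φ := by
    refine closure_mono fun x hx hx2 => hx ?_
    simp [hw, hx2]
  have hwc : HasCompactSupport w := hφc.mono' (subset_closure.trans hws)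
  have hw1 : ContDiff ℝ 1 w := by
    rw [contDiff_iff_contDiffAt]
    intro x
    by_cases hx : x ∈ tsupport φ
    · exact (hφ.contDiffAt.pow 2).div (h.contDiffAt (hxL x (hφs hx))) (hun x (hφs hx)).ne'
    · have : w =ᶠ[𝓝 x] 0 := notMem_tsupport_iff_eventuallyEq.1 fun h => hx (hws h)
      exact contDiffAt_const.congr_of_eventuallyEq this
  rw [← h.integral_fderiv hd hq hw1 hwc]
  have hqn : Continuous fun x : EuclideanSpace ℝ (Fin d) => q ‖x‖ := hq.comp continuous_norm
  have hun' : Continuous fun x : EuclideanSpace ℝ (Fin d) => u ‖x‖ :=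
    h.continuous_u.comp continuous_norm
  have hFn : Continuous fun x : EuclideanSpace ℝ (Fin d) => F ‖x‖ :=
    h.continuous_F.comp continuous_norm
  have hi1 : Integrable fun x => F ‖x‖ * fderiv ℝ w x x := by
    refine (hFn.mul (continuous_fderiv_apply_self hw1)).integrable_of_hasCompactSupport
      (HasCompactSupport.mul_left ?_)
    refine hwc.mono' fun x hx => ?_
    by_contra hx2
    exact hx (by simp [fderiv_of_notMem_tsupport ℝ hx2])
  have hi2 : Integrable fun x => q ‖x‖ * u ‖x‖ * w x :=
    ((hqn.mul hun').mul hw1.continuous).integrable_of_hasCompactSupport hwc.mul_left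
  have hi3 : Integrable fun x => ‖gradient φ x‖ ^ 2 := by
    have h1 : HasCompactSupport fun x => ‖gradient φ x‖ ^ 2 :=
      (HasCompactSupport.gradient hφc).comp_left (g := fun y => ‖y‖ ^ 2) (by simp)
    exact ((continuous_gradient hφ).norm.pow 2).integrable_of_hasCompactSupport h1
  have hi4 : Integrable fun x => q ‖x‖ * φ x ^ 2 := by
    have h1 : HasCompactSupport fun x => φ x ^ 2 :=
      hφc.comp_left (g := fun y : ℝ => y ^ 2) (by simp)
    exact (hqn.mul (hφ.continuous.pow 2)).integrable_of_hasCompactSupport h1.mul_left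
  refine integral_mono (hi1.add hi2) (hi3.add hi4) fun x => ?_
  by_cases hx : x ∈ tsupport φ
  · have hx' := hφs hx
    have hu0 := (hun x hx').ne'
    have hd1 : HasFDerivAt φ (fderiv ℝ φ x) x :=
      ((hφ.differentiable one_ne_zero) x).hasFDerivAt
    have hd2 := (hd1.pow 2).mul
      ((hasDerivAt_inv hu0).comp_hasFDerivAt x (h.hasFDerivAt (hxL x hx')))
    have hw' : w = (fun x => φ x ^ 2) * (Inv.inv ∘ fun x => u ‖x‖) := by
      ext y
      simp [hw, div_eq_mul_inv]
    rw [← hw'] at hd2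
    -- Picone: |∇φ - (φ/u)∇u|² = |∇φ|² - ∇u·∇(φ²/u), with ∇u = F(‖x‖)x.
    have e : ‖gradient φ x - (φ x / u ‖x‖ * F ‖x‖) • x‖ ^ 2 = ‖gradient φ x‖ ^ 2
        - F ‖x‖ * fderiv ℝ w x x := by
      rw [norm_sub_sq_real, inner_smul_right, inner_gradient_left, norm_smul, mul_pow,
        Real.norm_eq_abs, sq_abs, hd2.fderiv]
      simp
      field_simp
      ring
    have e2 : q ‖x‖ * u ‖x‖ * w x = q ‖x‖ * φ x ^ 2 := by
      simp only [hw]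
      field_simp
    have := sq_nonneg ‖gradient φ x - (φ x / u ‖x‖ * F ‖x‖) • x‖
    rw [e] at this
    simp only
    rw [e2]
    linarith
  · have h1 : fderiv ℝ w x = 0 := fderiv_of_notMem_tsupport ℝ fun h => hx (hws h)
    have h2 : φ x = 0 := image_eq_zero_of_notMem_tsupport hx
    have h3 : w x = 0 := by simp [hw, h2]
    simp [h1, h2, h3]

end

section
open Set Asymptotics Metric
open scoped BoundedContinuousFunction ENNReal

/-! ### Convergence in `L²` -/

theorem tendsto_eLpNorm_two_of_bounded {α E : Type*} [MeasurableSpace α] {μ : Measure α}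
    [IsFiniteMeasure μ] [NormedAddCommGroup E] {h : ℕ → α → E} (C : ℝ)
    (hm : ∀ n, AEStronglyMeasurable (h n) μ) (hb : ∀ n, ∀ᵐ x ∂μ, ‖h n x‖ ≤ C)
    (hlim : ∀ᵐ x ∂μ, Tendsto (fun n => h n x) atTop (𝓝 0)) :
    Tendsto (fun n => eLpNorm (h n) 2 μ) atTop (𝓝 0) := by
  have h1 : Tendsto (fun n => ∫⁻ x, ‖h n x‖ₑ ^ (2 : ℝ) ∂μ) atTop (𝓝 (∫⁻ _, 0 ∂μ)) := by
    refine tendsto_lintegral_of_dominated_convergence' (fun _ => ENNReal.ofReal C ^ (2 : ℝ))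
      (fun n => (hm n).enorm.pow_const _) (fun n => ?_) ?_ ?_
    · filter_upwards [hb n] with x hx
      have : ‖h n x‖ₑ ≤ ENNReal.ofReal C := by
        rw [← ofReal_norm]
        exact ENNReal.ofReal_le_ofReal hx
      gcongr
    · rw [lintegral_const]
      exact ENNReal.mul_ne_top (by simp) (measure_ne_top _ _)
    · filter_upwards [hlim] with x hx
      have h2 : Tendsto (fun n => ‖h n x‖ₑ) atTop (𝓝 0) := by
        simpa [Function.comp_def] using (continuous_enorm.tendsto (0 : E)).comp hx
      simpa using h2.ennrpow_const 2
  have h2 := h1.ennrpow_const (1 / 2)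
  simpa [eLpNorm_eq_lintegral_rpow_enorm_toReal] using h2

theorem tendsto_integral_inner {α E : Type*} [MeasurableSpace α] {μ : Measure α}
    [NormedAddCommGroup E] [InnerProductSpace ℝ E] {f g : α → E} {fn gn : ℕ → α → E}
    (hf : MemLp f 2 μ) (hg : MemLp g 2 μ) (hfn : ∀ n, MemLp (fn n) 2 μ)
    (hgn : ∀ n, MemLp (gn n) 2 μ)
    (hf1 : Tendsto (fun n => eLpNorm (fun x => fn n x - f x) 2 μ) atTop (𝓝 0))
    (hg1 : Tendsto (fun n => eLpNorm (fun x => gn n x - g x) 2 μ) atTop (𝓝 0)) :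
    Tendsto (fun n => ∫ x, inner ℝ (fn n x) (gn n x) ∂μ) atTop
      (𝓝 (∫ x, inner ℝ (f x) (g x) ∂μ)) := by
  have e : ∀ {a b : α → E} (ha : MemLp a 2 μ) (hb : MemLp b 2 μ),
      ∫ x, inner ℝ (a x) (b x) ∂μ = inner ℝ (ha.toLp a) (hb.toLp b) := by
    intro a b ha hb
    rw [L2.inner_def]
    refine integral_congr_ae ?_
    filter_upwards [ha.coeFn_toLp, hb.coeFn_toLp] with x h1 h2
    rw [h1, h2]
  rw [e hf hg]
  simp_rw [fun n => e (hfn n) (hgn n)]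
  exact ((Lp.tendsto_Lp_iff_tendsto_eLpNorm'' fn hfn f hf).2 hf1).inner
    ((Lp.tendsto_Lp_iff_tendsto_eLpNorm'' gn hgn g hg).2 hg1)

theorem tendsto_eLpNorm_const {α E : Type*} [MeasurableSpace α] {μ : Measure α}
    [NormedAddCommGroup E] (f : α → E) :
    Tendsto (fun _ : ℕ => eLpNorm (fun x => f x - f x) 2 μ) atTop (𝓝 0) := by
  simp

/-! ### Radial solutions as elements of H¹₀ of the ball. -/

variable {d : ℕ} {L R : ℝ} {q u F : ℝ → ℝ}

instance isFiniteMeasure_restrict_ball :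
    IsFiniteMeasure (volume.restrict (ball (0 : EuclideanSpace ℝ (Fin d)) R)) :=
  ⟨by simpa using measure_ball_lt_top⟩

namespace IsTestFunction

variable {Ω : Set (EuclideanSpace ℝ (Fin d))} {φ : EuclideanSpace ℝ (Fin d) → ℝ}

theorem contDiff_one (h : IsTestFunction Ω φ) : ContDiff ℝ 1 φ := h.smooth.of_le (by simp)

theorem memLp (h : IsTestFunction Ω φ) : MemLp φ 2 (volume.restrict Ω) :=
  (h.contDiff_one.continuous.memLp_of_hasCompactSupport h.hasCompactSupport).restrict _

theorem memLp_gradient (h : IsTestFunction Ω φ) : MemLp (gradient φ) 2 (volume.restrict Ω) :=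
  ((continuous_gradient h.contDiff_one).memLp_of_hasCompactSupport
    (HasCompactSupport.gradient h.hasCompactSupport)).restrict _

end IsTestFunction

theorem integral_gradient_eq_zero {w : EuclideanSpace ℝ (Fin d) → ℝ} (hw : ContDiff ℝ 1 w)
    (hwc : HasCompactSupport w) : ∫ x, gradient w x = 0 := by
  have hi : Integrable (gradient w) := (continuous_gradient hw).integrable_of_hasCompactSupport
    (HasCompactSupport.gradient hwc)
  refine ext_inner_left ℝ fun v => ?_
  rw [← integral_inner hi, inner_zero_right]
  have hi2 : Integrable fun x => fderiv ℝ w x v :=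
    ((hw.continuous_fderiv one_ne_zero).clm_apply continuous_const).integrable_of_hasCompactSupport
      (hwc.fderiv_apply (𝕜 := ℝ) v)
  have h := integral_mul_fderiv_eq_neg_fderiv_mul_of_integrable (μ := volume)
    (f := fun _ : EuclideanSpace ℝ (Fin d) => (1 : ℝ)) (g := w) (v := v) (by simp)
    (by simpa using hi2)
    (by simpa using hw.continuous.integrable_of_hasCompactSupport hwc) (by simp)
    (fun x _ => (hw.differentiable one_ne_zero) x)
  simpa [inner_gradient_right] using h

theorem IsRadialSolution.continuous_grad (h : IsRadialSolution d L q u F) :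
    Continuous fun x : EuclideanSpace ℝ (Fin d) => F ‖x‖ • x :=
  (h.continuous_F.comp continuous_norm).smul continuous_id

theorem IsRadialSolution.isWeakGradient (h : IsRadialSolution d L q u F) (hRL : R ≤ L) :
    IsWeakGradient (ball 0 R) (fun x : EuclideanSpace ℝ (Fin d) => u ‖x‖)
      (fun x => F ‖x‖ • x) := by
  intro φ hφ
  have hu : Continuous fun x : EuclideanSpace ℝ (Fin d) => u ‖x‖ :=
    h.continuous_u.comp continuous_norm
  have hφ1 := hφ.contDiff_one
  set w : EuclideanSpace ℝ (Fin d) → ℝ := fun x => φ x * u ‖x‖ with hw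
  have hws : tsupport w ⊆ tsupport φ := tsupport_mul_subset_left
  have hwc : HasCompactSupport w := hφ.hasCompactSupport.mul_right
  have hL : ∀ x ∈ tsupport φ, ‖x‖ < L := fun x hx =>
    lt_of_lt_of_le (by simpa using hφ.tsupport_subset hx) hRL
  have hw1 : ContDiff ℝ 1 w := by
    rw [contDiff_iff_contDiffAt]
    intro x
    by_cases hx : x ∈ tsupport φ
    · exact hφ1.contDiffAt.mul (h.contDiffAt (hL x hx))
    · have : w =ᶠ[𝓝 x] 0 := notMem_tsupport_iff_eventuallyEq.1 fun h => hx (hws h)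
      exact contDiffAt_const.congr_of_eventuallyEq this
  have hgrad : ∀ x, gradient w x = u ‖x‖ • gradient φ x + φ x • (F ‖x‖ • x) := by
    intro x
    by_cases hx : x ∈ tsupport φ
    · refine HasGradientAt.gradient ?_
      have h1 := (((hφ1.differentiable one_ne_zero) x).hasFDerivAt).mul
        (h.hasFDerivAt (hL x hx))
      rw [hasGradientAt_iff_hasFDerivAt]
      refine h1.congr_fderiv ?_
      ext v
      simp
      ring
    · rw [gradient_eq_zero_of_notMem_tsupport fun h => hx (hws h),
        gradient_eq_zero_of_notMem_tsupport hx, image_eq_zero_of_notMem_tsupport hx]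
      simp
  have hi1 : Integrable fun x => u ‖x‖ • gradient φ x :=
    (hu.smul (continuous_gradient hφ1)).integrable_of_hasCompactSupport
      (HasCompactSupport.gradient hφ.hasCompactSupport).smul_left
  have hi2 : Integrable fun x => φ x • (F ‖x‖ • x) :=
    (hφ1.continuous.smul h.continuous_grad).integrable_of_hasCompactSupport
      hφ.hasCompactSupport.smul_right
  have hz : ∀ x ∉ ball 0 R, φ x = 0 ∧ gradient φ x = 0 := fun x hx =>
    ⟨image_eq_zero_of_notMem_tsupport fun h => hx (hφ.tsupport_subset h),
      gradient_eq_zero_of_notMem_tsupport fun h => hx (hφ.tsupport_subset h)⟩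
  rw [setIntegral_eq_integral_of_forall_compl_eq_zero fun x hx => by rw [(hz x hx).2, smul_zero],
    setIntegral_eq_integral_of_forall_compl_eq_zero fun x hx => by rw [(hz x hx).1, zero_smul],
    eq_neg_iff_add_eq_zero, ← integral_add hi1 hi2, ← integral_gradient_eq_zero hw1 hwc]
  exact integral_congr_ae (.of_forall fun x => (hgrad x).symm)

/-- A radial solution vanishing on the sphere belongs to `H¹₀` of the ball. -/
theorem IsRadialSolution.memH10 (h : IsRadialSolution d L q u F) (hR : 0 < R) (hRL : R < L)
    (huR : u R = 0) :
    MemH10 (ball 0 R) (fun x : EuclideanSpace ℝ (Fin d) => u ‖x‖) (fun x => F ‖x‖ • x) := by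
  have hu : Continuous fun x : EuclideanSpace ℝ (Fin d) => u ‖x‖ :=
    h.continuous_u.comp continuous_norm
  -- In the smooth variable r = ‖x‖² the solution is u(√r), whose derivative F(√r)/2 is continuous
  -- up to r = 0. It suffices to approximate this derivative and integrate.
  set f : ℝ → ℝ := fun r => F (√r) / 2 with hf
  have hfc : Continuous f := (h.continuous_F.comp Real.continuous_sqrt).div_const 2
  obtain ⟨M, hM⟩ := (isCompact_Icc (a := 0) (b := R ^ 2)).exists_bound_of_continuousOn
    hfc.continuousOn
  obtain ⟨M', hM'⟩ := (isCompact_Icc (a := 0) (b := R)).exists_bound_of_continuousOn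
    h.continuous_u.continuousOn
  have hmem : ∀ x : EuclideanSpace ℝ (Fin d), x ∈ ball 0 R → ‖x‖ < R := fun x hx => by
    simpa using hx
  have hsq : ∀ x : EuclideanSpace ℝ (Fin d), x ∈ ball 0 R → ‖x‖ ^ 2 ∈ Icc 0 (R ^ 2) :=
    fun x hx => ⟨by positivity, pow_le_pow_left₀ (norm_nonneg _) (hmem x hx).le 2⟩
  have hM0 : 0 ≤ M := (norm_nonneg _).trans (hM 0 ⟨le_rfl, by positivity⟩)
  have hfx : ∀ x : EuclideanSpace ℝ (Fin d), F ‖x‖ = 2 * f (‖x‖ ^ 2) := fun x => by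
    simp only [hf, Real.sqrt_sq (norm_nonneg x)]
    ring
  choose P hP using fun n : ℕ => exists_polynomial_near_of_continuousOn 0 (R ^ 2) f
    hfc.continuousOn (1 / ((n : ℝ) + 1)) (by positivity)
  -- The cutoff is 0 for R² - r ≤ 1/(n+1) and 1 for R² - r ≥ 2/(n+1).
  set χ : ℕ → ℝ → ℝ := fun n r => Real.smoothTransition (((n : ℝ) + 1) * (R ^ 2 - r) - 1)
    with hχ
  have hχs : ∀ n, ContDiff ℝ ∞ (χ n) := fun n =>
    Real.smoothTransition.contDiff.comp (by fun_prop)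
  set k : ℕ → ℝ → ℝ := fun n r => (P n).eval r * χ n r with hk
  have hks : ∀ n, ContDiff ℝ ∞ (k n) := fun n =>
    ContDiff.mul (by simpa using (P n).contDiff_aeval (𝕜 := ℝ) ∞) (hχs n)
  have hkc : ∀ n, Continuous (k n) := fun n => (hks n).continuous
  have hχlim : ∀ r, r < R ^ 2 → ∀ᶠ n : ℕ in atTop, χ n r = 1 := by
    intro r hr
    obtain ⟨N, hN⟩ := exists_nat_gt (2 / (R ^ 2 - r))
    filter_upwards [eventually_ge_atTop N] with n hn
    refine Real.smoothTransition.one_of_one_le ?_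
    have h1 : 0 < R ^ 2 - r := by linarith
    have h2 : 2 / (R ^ 2 - r) < n := hN.trans_le (by exact_mod_cast hn)
    rw [div_lt_iff₀ h1] at h2
    nlinarith
  have hPlim : ∀ r ∈ Icc 0 (R ^ 2), Tendsto (fun n => (P n).eval r) atTop (𝓝 (f r)) := by
    intro r hr
    rw [tendsto_iff_dist_tendsto_zero]
    exact squeeze_zero (fun _ => dist_nonneg) (fun n => (hP n r hr).le)
      tendsto_one_div_add_atTop_nhds_zero_nat
  have hklim : ∀ r, 0 ≤ r → r < R ^ 2 → Tendsto (fun n => k n r) atTop (𝓝 (f r)) := by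
    intro r hr0 hr
    refine (hPlim r ⟨hr0, hr.le⟩).congr' ?_
    filter_upwards [hχlim r hr] with n hn
    simp [hk, hn]
  have hkb : ∀ n, ∀ r ∈ Icc 0 (R ^ 2), |k n r| ≤ M + 1 := by
    intro n r hr
    have h1 : |χ n r| ≤ 1 := by
      rw [abs_of_nonneg (Real.smoothTransition.nonneg _)]
      exact Real.smoothTransition.le_one _
    have h2 : |(P n).eval r| ≤ M + 1 := by
      have h3 := abs_sub_abs_le_abs_sub ((P n).eval r) (f r)
      have h4 := hM r hr
      rw [Real.norm_eq_abs] at h4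
      have h5 : 1 / ((n : ℝ) + 1) ≤ 1 := by
        rw [div_le_one (by positivity)]
        linarith [n.cast_nonneg (α := ℝ)]
      linarith [hP n r hr]
    simp only [hk]
    rw [abs_mul]
    calc _ ≤ (M + 1) * 1 := by gcongr
      _ = _ := mul_one _
  have hkz : ∀ n : ℕ, ∀ r, R ^ 2 - 1 / ((n : ℝ) + 1) ≤ r → k n r = 0 := by
    intro n r hr
    have h1 : (0 : ℝ) < (n : ℝ) + 1 := by positivity
    have : χ n r = 0 := by
      refine Real.smoothTransition.zero_of_nonpos ?_
      have h2 : R ^ 2 - r ≤ 1 / ((n : ℝ) + 1) := by linarith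
      rw [le_div_iff₀ h1] at h2
      linarith
    simp [hk, this]
  -- Integrating from R² makes the approximants vanish near the sphere; their limit is u because
  -- u(R) = 0.
  set p : ℕ → ℝ → ℝ := fun n r => ∫ t in (R ^ 2)..r, k n t with hp
  have hpd : ∀ n r, HasDerivAt (p n) (k n r) r := fun n r =>
    intervalIntegral.integral_hasDerivAt_right ((hkc n).intervalIntegrable _ _)
      ((hkc n).stronglyMeasurableAtFilter _ _) (hkc n).continuousAt
  have hps : ∀ n, ContDiff ℝ ∞ (p n) := fun n => by
    rw [contDiff_infty_iff_deriv]
    refine ⟨fun r => (hpd n r).differentiableAt, ?_⟩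
    rw [show deriv (p n) = k n from funext fun r => (hpd n r).deriv]
    exact hks n
  have hpz : ∀ n : ℕ, ∀ r, R ^ 2 - 1 / ((n : ℝ) + 1) ≤ r → p n r = 0 := by
    intro n r hr
    have : ∀ t ∈ uIcc (R ^ 2) r, k n t = 0 := fun t ht => hkz n t <| by
      have h1 : (0 : ℝ) < 1 / ((n : ℝ) + 1) := by positivity
      have := (mem_uIcc.1 ht)
      rcases this with h | h <;> linarith [h.1]
    simp only [hp]
    rw [intervalIntegral.integral_congr (g := fun _ => 0) this]
    simp
  have hpb : ∀ n, ∀ r ∈ Icc 0 (R ^ 2), |p n r| ≤ (M + 1) * R ^ 2 := by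
    intro n r hr
    have h1 := intervalIntegral.norm_integral_le_of_norm_le_const (a := R ^ 2) (b := r)
      (f := k n) (C := M + 1) fun t ht => hkb n t <| by
        rw [uIoc_of_ge hr.2] at ht
        exact ⟨hr.1.trans ht.1.le, ht.2⟩
    refine h1.trans ?_
    have : |r - R ^ 2| ≤ R ^ 2 := by
      rw [abs_le]
      constructor <;> linarith [hr.1, hr.2, sq_nonneg R]
    gcongr
  have hplim : ∀ r ∈ Icc 0 (R ^ 2), Tendsto (fun n => p n r) atTop
      (𝓝 (∫ t in (R ^ 2)..r, f t)) := by
    intro r hr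
    refine intervalIntegral.tendsto_integral_filter_of_dominated_convergence (fun _ => M + 1)
      (.of_forall fun n => (hkc n).aestronglyMeasurable) (.of_forall fun n => .of_forall
      fun t ht => ?_) (by simp) ?_
    · rw [uIoc_of_ge hr.2] at ht
      exact hkb n t ⟨hr.1.trans ht.1.le, ht.2⟩
    · have h0 : ∀ᵐ t : ℝ, t ≠ R ^ 2 := by
        rw [ae_iff]
        simp
      filter_upwards [h0] with t ht0 ht
      rw [uIoc_of_ge hr.2] at ht
      exact hklim t (hr.1.trans ht.1.le) (lt_of_le_of_ne ht.2 ht0)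
  have hueq : ∀ ρ, 0 ≤ ρ → ρ ≤ R → u ρ = ∫ t in (R ^ 2)..(ρ ^ 2), f t := by
    intro ρ hρ0 hρR
    have hI : ∀ t ∈ uIcc R ρ, 0 ≤ t ∧ t ≤ R := fun t ht => by
      rw [uIcc_of_ge hρR] at ht
      exact ⟨hρ0.trans ht.1, ht.2⟩
    have h1 : ∫ t in R..ρ, t * F t = u ρ - u R := by
      refine intervalIntegral.integral_eq_sub_of_hasDerivAt (fun t ht => ?_)
        ((continuous_id.mul h.continuous_F).intervalIntegrable _ _)
      refine h.hasDerivAt_u t ?_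
      rw [abs_of_nonneg (hI t ht).1]
      exact (hI t ht).2.trans_lt hRL
    have h2 := intervalIntegral.integral_comp_mul_deriv (a := R) (b := ρ) (f := fun t : ℝ => t ^ 2)
      (f' := fun t => 2 * t) (g := f) (fun t _ => by simpa using hasDerivAt_pow 2 t)
      (by fun_prop) hfc
    rw [huR, sub_zero] at h1
    rw [← h1, ← h2]
    refine intervalIntegral.integral_congr fun t ht => ?_
    simp only [hf, Function.comp_apply, Real.sqrt_sq (hI t ht).1]
    ring
  have hgrad : ∀ n, ∀ x : EuclideanSpace ℝ (Fin d),
      gradient (fun x : EuclideanSpace ℝ (Fin d) => p n (‖x‖ ^ 2)) x = (2 * k n (‖x‖ ^ 2)) • x := by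
    intro n x
    refine HasGradientAt.gradient ?_
    rw [hasGradientAt_iff_hasFDerivAt]
    refine ((hpd n _).comp_hasFDerivAt x (hasStrictFDerivAt_norm_sq x).hasFDerivAt).congr_fderiv ?_
    ext v
    simp
    ring
  have hsm : ∀ n, ContDiff ℝ ∞ fun x : EuclideanSpace ℝ (Fin d) => p n (‖x‖ ^ 2) := fun n =>
    (hps n).comp (contDiff_norm_sq ℝ)
  refine ⟨⟨?_, ?_, h.isWeakGradient hRL.le⟩, fun n x => p n (‖x‖ ^ 2), fun n => ?_, ?_, ?_⟩
  · refine MemLp.of_bound hu.aestronglyMeasurable M' ?_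
    filter_upwards [ae_restrict_mem measurableSet_ball] with x hx
    exact hM' _ ⟨norm_nonneg _, (hmem x hx).le⟩
  · refine MemLp.of_bound h.continuous_grad.aestronglyMeasurable (2 * M * R) ?_
    filter_upwards [ae_restrict_mem measurableSet_ball] with x hx
    have := hM _ (hsq x hx)
    rw [norm_smul, hfx, norm_mul, Real.norm_ofNat]
    have := (hmem x hx).le
    gcongr
  · have hs : Function.support (fun x : EuclideanSpace ℝ (Fin d) => p n (‖x‖ ^ 2))
        ⊆ {x | ‖x‖ ^ 2 ≤ R ^ 2 - 1 / ((n : ℝ) + 1)} := fun x hx => by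
      by_contra hlt
      exact hx (hpz n _ (not_le.1 hlt).le)
    have hcl : IsClosed {x : EuclideanSpace ℝ (Fin d) | ‖x‖ ^ 2 ≤ R ^ 2 - 1 / ((n : ℝ) + 1)} :=
      isClosed_le (by fun_prop) continuous_const
    have hsub : {x : EuclideanSpace ℝ (Fin d) | ‖x‖ ^ 2 ≤ R ^ 2 - 1 / ((n : ℝ) + 1)}
        ⊆ ball 0 R := fun x hx => by
      have h1 : (0 : ℝ) < 1 / ((n : ℝ) + 1) := by positivity
      have h2 : ‖x‖ ^ 2 < R ^ 2 := by
        have : ‖x‖ ^ 2 ≤ R ^ 2 - 1 / ((n : ℝ) + 1) := hx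
        linarith
      simpa using lt_of_pow_lt_pow_left₀ 2 hR.le h2
    refine ⟨hsm n, ?_, (closure_minimal hs hcl).trans hsub⟩
    exact HasCompactSupport.of_support_subset_isCompact (isCompact_closedBall 0 R)
      ((hs.trans hsub).trans ball_subset_closedBall)
  · refine tendsto_eLpNorm_two_of_bounded ((M + 1) * R ^ 2 + M')
      (fun n => ((hsm n).continuous.sub hu).aestronglyMeasurable) (fun n => ?_) ?_
    · filter_upwards [ae_restrict_mem measurableSet_ball] with x hx
      exact (norm_sub_le _ _).trans (add_le_add (hpb n _ (hsq x hx))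
        (hM' _ ⟨norm_nonneg _, (hmem x hx).le⟩))
    · filter_upwards [ae_restrict_mem measurableSet_ball] with x hx
      have h1 := (hplim _ (hsq x hx)).sub_const (u ‖x‖)
      rwa [← hueq _ (norm_nonneg _) (hmem x hx).le, sub_self] at h1
  · refine tendsto_eLpNorm_two_of_bounded ((2 * (M + 1) + 2 * M) * R)
      (fun n => ((continuous_gradient ((hsm n).of_le (by simp))).sub
        h.continuous_grad).aestronglyMeasurable) (fun n => ?_) ?_
    · filter_upwards [ae_restrict_mem measurableSet_ball] with x hx
      rw [hgrad, ← sub_smul, norm_smul, hfx]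
      have h1 := hM _ (hsq x hx)
      have h2 := hkb n _ (hsq x hx)
      have h3 := (hmem x hx).le
      have h4 : ‖2 * k n (‖x‖ ^ 2) - 2 * f (‖x‖ ^ 2)‖ ≤ 2 * (M + 1) + 2 * M := by
        refine (norm_sub_le _ _).trans ?_
        rw [norm_mul 2 (k n (‖x‖ ^ 2)), norm_mul 2 (f (‖x‖ ^ 2)), Real.norm_ofNat]
        exact add_le_add (mul_le_mul_of_nonneg_left h2 zero_le_two)
          (mul_le_mul_of_nonneg_left h1 zero_le_two)
      gcongr
    · filter_upwards [ae_restrict_mem measurableSet_ball] with x hx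
      have h0 : ‖x‖ ^ 2 < R ^ 2 := pow_lt_pow_left₀ (hmem x hx) (norm_nonneg _) two_ne_zero
      have h1 := (((hklim _ (by positivity) h0).const_mul 2).smul_const x).sub_const (F ‖x‖ • x)
      rw [hfx, sub_self, ← hfx] at h1
      simpa [hgrad] using h1

end

/-! ### From a positive radial solution to the least Dirichlet eigenvalue. -/

section
open Set Asymptotics Metric
open scoped BoundedContinuousFunction ENNReal

variable {d : ℕ} {L R s μ E : ℝ} {u F : ℝ → ℝ}

theorem integral_inner_real {α : Type*} [MeasurableSpace α] (ν : Measure α) (f g : α → ℝ) :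
    ∫ x, inner ℝ (f x) (g x) ∂ν = ∫ x, f x * g x ∂ν :=
  integral_congr_ae (.of_forall fun x => by simp [mul_comm])

/-- The potential is bounded on the ball. -/
theorem norm_potential_le (hs : 0 < s) (hμ : 0 ≤ μ) {x : EuclideanSpace ℝ (Fin d)}
    (hx : x ∈ ball 0 R) : ‖μ * ‖x‖ ^ (2 * s)‖ ≤ μ * R ^ (2 * s) := by
  have h1 : ‖x‖ < R := by simpa using hx
  rw [Real.norm_of_nonneg (by positivity)]
  gcongr

theorem continuous_potential (hs : 0 < s) (μ : ℝ) :
    Continuous fun x : EuclideanSpace ℝ (Fin d) => μ * ‖x‖ ^ (2 * s) :=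
  continuous_const.mul ((Real.continuous_rpow_const (by positivity)).comp continuous_norm)

/-- Multiplication by the potential is bounded on `L²`. -/
theorem memLp_potential_mul (hs : 0 < s) (hμ : 0 ≤ μ) {f : EuclideanSpace ℝ (Fin d) → ℝ}
    (hf : MemLp f 2 (volume.restrict (ball 0 R))) :
    MemLp (fun x => μ * ‖x‖ ^ (2 * s) * f x) 2 (volume.restrict (ball 0 R)) := by
  refine hf.of_le_mul (c := μ * R ^ (2 * s))
    ((continuous_potential hs μ).aestronglyMeasurable.mul hf.1) ?_
  filter_upwards [ae_restrict_mem measurableSet_ball] with x hx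
  rw [norm_mul]
  exact mul_le_mul_of_nonneg_right (norm_potential_le hs hμ hx) (norm_nonneg _)

theorem tendsto_potential_mul (hs : 0 < s) (hμ : 0 ≤ μ) {f : EuclideanSpace ℝ (Fin d) → ℝ}
    {fn : ℕ → EuclideanSpace ℝ (Fin d) → ℝ}
    (h : Tendsto (fun n => eLpNorm (fun x => fn n x - f x) 2 (volume.restrict (ball 0 R))) atTop
      (𝓝 0)) :
    Tendsto (fun n => eLpNorm (fun x => μ * ‖x‖ ^ (2 * s) * fn n x - μ * ‖x‖ ^ (2 * s) * f x) 2
      (volume.restrict (ball 0 R))) atTop (𝓝 0) := by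
  have h1 := ENNReal.Tendsto.const_mul (a := ENNReal.ofReal (μ * R ^ (2 * s))) h (.inr (by simp))
  rw [mul_zero] at h1
  refine tendsto_of_tendsto_of_tendsto_of_le_of_le tendsto_const_nhds h1 (fun _ => zero_le)
    fun n => eLpNorm_le_mul_eLpNorm_of_ae_le_mul ?_ 2
  filter_upwards [ae_restrict_mem measurableSet_ball] with x hx
  rw [← mul_sub, norm_mul]
  exact mul_le_mul_of_nonneg_right (norm_potential_le hs hμ hx) (norm_nonneg _)

theorem integrable_inner {α V : Type*} [MeasurableSpace α] {ν : Measure α}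
    [NormedAddCommGroup V] [InnerProductSpace ℝ V] {f g : α → V} (hf : MemLp f 2 ν)
    (hg : MemLp g 2 ν) : Integrable (fun x => inner ℝ (f x) (g x)) ν := by
  have h := L2.integrable_inner (𝕜 := ℝ) (hf.toLp f) (hg.toLp g)
  refine h.congr ?_
  filter_upwards [hf.coeFn_toLp, hg.coeFn_toLp] with x h1 h2
  rw [h1, h2]

theorem integral_form_eq (hs : 0 < s) (hμ : 0 ≤ μ) {v w : EuclideanSpace ℝ (Fin d) → ℝ}
    {g h : EuclideanSpace ℝ (Fin d) → EuclideanSpace ℝ (Fin d)}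
    (hv : MemLp v 2 (volume.restrict (ball 0 R))) (hw : MemLp w 2 (volume.restrict (ball 0 R)))
    (hg : MemLp g 2 (volume.restrict (ball 0 R))) (hh : MemLp h 2 (volume.restrict (ball 0 R))) :
    ∫ x in ball 0 R, (inner ℝ (g x) (h x) + μ * ‖x‖ ^ (2 * s) * v x * w x)
      = (∫ x in ball 0 R, inner ℝ (g x) (h x))
        + ∫ x in ball 0 R, inner ℝ (μ * ‖x‖ ^ (2 * s) * v x) (w x) := by
  rw [← integral_add (integrable_inner hg hh) (integrable_inner (memLp_potential_mul hs hμ hv) hw)]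
  exact integral_congr_ae (.of_forall fun x => by simp [mul_comm])

theorem integral_form_sub_eq (hs : 0 < s) (hμ : 0 ≤ μ) (E : ℝ)
    {v w : EuclideanSpace ℝ (Fin d) → ℝ}
    {g h : EuclideanSpace ℝ (Fin d) → EuclideanSpace ℝ (Fin d)}
    (hv : MemLp v 2 (volume.restrict (ball 0 R))) (hw : MemLp w 2 (volume.restrict (ball 0 R)))
    (hg : MemLp g 2 (volume.restrict (ball 0 R))) (hh : MemLp h 2 (volume.restrict (ball 0 R))) :
    (∫ x in ball 0 R, (inner ℝ (g x) (h x) + μ * ‖x‖ ^ (2 * s) * v x * w x))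
        - E * ∫ x in ball 0 R, v x * w x
      = ∫ x in ball 0 R, (inner ℝ (g x) (h x) + radialPotential s μ E ‖x‖ * v x * w x) := by
  have h1 := integrable_inner hg hh
  have h2 := integrable_inner (memLp_potential_mul hs hμ hv) hw
  have h3 := (integrable_inner hv hw).const_mul E
  rw [integral_form_eq hs hμ hv hw hg hh, ← integral_inner_real, ← integral_const_mul,
    ← integral_add h1 h2]
  refine (integral_sub (h1.add h2) h3).symm.trans (integral_congr_ae (.of_forall fun x => ?_))
  simp [radialPotential]
  ring

/-- Both sides of the weak eigenvalue equation pass to the limit in `H¹`. -/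
theorem tendsto_form (hs : 0 < s) (hμ : 0 ≤ μ) {v w : EuclideanSpace ℝ (Fin d) → ℝ}
    {g h : EuclideanSpace ℝ (Fin d) → EuclideanSpace ℝ (Fin d)}
    {vn wn : ℕ → EuclideanSpace ℝ (Fin d) → ℝ}
    {gn hn : ℕ → EuclideanSpace ℝ (Fin d) → EuclideanSpace ℝ (Fin d)}
    (hv : MemLp v 2 (volume.restrict (ball 0 R))) (hw : MemLp w 2 (volume.restrict (ball 0 R)))
    (hg : MemLp g 2 (volume.restrict (ball 0 R))) (hh : MemLp h 2 (volume.restrict (ball 0 R)))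
    (hvn : ∀ n, MemLp (vn n) 2 (volume.restrict (ball 0 R)))
    (hwn : ∀ n, MemLp (wn n) 2 (volume.restrict (ball 0 R)))
    (hgn : ∀ n, MemLp (gn n) 2 (volume.restrict (ball 0 R)))
    (hhn : ∀ n, MemLp (hn n) 2 (volume.restrict (ball 0 R)))
    (lv : Tendsto (fun n => eLpNorm (fun x => vn n x - v x) 2 (volume.restrict (ball 0 R))) atTop
      (𝓝 0))
    (lw : Tendsto (fun n => eLpNorm (fun x => wn n x - w x) 2 (volume.restrict (ball 0 R))) atTop
      (𝓝 0))
    (lg : Tendsto (fun n => eLpNorm (fun x => gn n x - g x) 2 (volume.restrict (ball 0 R))) atTop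
      (𝓝 0))
    (lh : Tendsto (fun n => eLpNorm (fun x => hn n x - h x) 2 (volume.restrict (ball 0 R))) atTop
      (𝓝 0)) :
    Tendsto (fun n => (∫ x in ball 0 R,
        (inner ℝ (gn n x) (hn n x) + μ * ‖x‖ ^ (2 * s) * vn n x * wn n x))
        - E * ∫ x in ball 0 R, vn n x * wn n x) atTop
      (𝓝 ((∫ x in ball 0 R, (inner ℝ (g x) (h x) + μ * ‖x‖ ^ (2 * s) * v x * w x))
        - E * ∫ x in ball 0 R, v x * w x)) := by
  have h1 := tendsto_integral_inner hg hh hgn hhn lg lh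
  have h2 := tendsto_integral_inner (memLp_potential_mul hs hμ hv) hw
    (fun n => memLp_potential_mul hs hμ (hvn n)) hwn (tendsto_potential_mul hs hμ lv) lw
  have h3 := tendsto_integral_inner hv hw hvn hwn lv lw
  rw [integral_form_eq hs hμ hv hw hg hh, ← integral_inner_real _ v w]
  simp_rw [fun n => integral_form_eq hs hμ (hvn n) (hwn n) (hgn n) (hhn n),
    ← fun n => integral_inner_real (volume.restrict (ball 0 R)) (vn n) (wn n)]
  exact (h1.add h2).sub (h3.const_mul E)

theorem IsTestFunction.eq_zero {Ω : Set (EuclideanSpace ℝ (Fin d))}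
    {φ : EuclideanSpace ℝ (Fin d) → ℝ} (h : IsTestFunction Ω φ) {x : EuclideanSpace ℝ (Fin d)}
    (hx : x ∉ Ω) : φ x = 0 ∧ gradient φ x = 0 ∧ fderiv ℝ φ x = 0 :=
  have hx' : x ∉ tsupport φ := fun h' => hx (h.tsupport_subset h')
  ⟨image_eq_zero_of_notMem_tsupport hx', gradient_eq_zero_of_notMem_tsupport hx',
    fderiv_of_notMem_tsupport ℝ hx'⟩

/-- The lower bound for the quadratic form on `H¹₀`. -/
theorem IsRadialSolution.le_form (h : IsRadialSolution d L (radialPotential s μ E) u F)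
    (hd : 1 ≤ d) (hs : 0 < s) (hμ : 0 ≤ μ) (hRL : R ≤ L)
    (hpos : ∀ ρ, 0 ≤ ρ → ρ < R → 0 < u ρ) {v : EuclideanSpace ℝ (Fin d) → ℝ}
    {g : EuclideanSpace ℝ (Fin d) → EuclideanSpace ℝ (Fin d)} (hv : MemH10 (ball 0 R) v g) :
    E * ∫ x in ball 0 R, v x * v x
      ≤ ∫ x in ball 0 R, (inner ℝ (g x) (g x) + μ * ‖x‖ ^ (2 * s) * v x * v x) := by
  obtain ⟨φ, hφ, l1, l2⟩ := hv.exists_approx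
  have hlim := tendsto_form (E := E) hs hμ hv.memLp hv.memLp hv.memLp_grad hv.memLp_grad
    (fun n => (hφ n).memLp) (fun n => (hφ n).memLp) (fun n => (hφ n).memLp_gradient)
    (fun n => (hφ n).memLp_gradient) l1 l1 l2 l2
  refine sub_nonneg.1 (ge_of_tendsto' hlim fun n => ?_)
  have hn := hφ n
  have h1 := h.integral_nonneg hd (continuous_radialPotential hs μ E) hRL hpos hn.contDiff_one
    hn.hasCompactSupport hn.tsupport_subset
  rw [← setIntegral_eq_integral_of_forall_compl_eq_zero (s := ball 0 R) fun x hx => by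
    obtain ⟨e1, e2, -⟩ := hn.eq_zero hx
    simp [e1, e2]] at h1
  rw [integral_form_sub_eq hs hμ E hn.memLp hn.memLp hn.memLp_gradient hn.memLp_gradient]
  refine h1.trans_eq (integral_congr_ae (.of_forall fun x => ?_))
  simp only [real_inner_self_eq_norm_sq]
  ring

/-- A radial solution that is positive on `[0, R)` and vanishes at `R` gives the least
Dirichlet eigenvalue. -/
theorem IsRadialSolution.isLeast (h : IsRadialSolution d L (radialPotential s μ E) u F)
    (hd : 1 ≤ d) (hs : 0 < s) (hμ : 0 ≤ μ) (hR : 0 < R) (hRL : R < L)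
    (hpos : ∀ ρ, 0 ≤ ρ → ρ < R → 0 < u ρ) (huR : u R = 0) :
    IsLeast (ballEigenvalues d s μ R) E := by
  have hU := h.memH10 (d := d) hR hRL huR
  refine ⟨⟨fun x => u ‖x‖, fun x => F ‖x‖ • x, hU, ?_, ?_⟩, ?_⟩
  · intro h0
    have h1 : ∀ᵐ x ∂(volume.restrict (ball (0 : EuclideanSpace ℝ (Fin d)) R)), False := by
      filter_upwards [h0, ae_restrict_mem measurableSet_ball] with x hx hxb
      exact (hpos _ (norm_nonneg x) (by simpa using hxb)).ne' hx
    rw [ae_iff] at h1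
    simp only [not_false_eq_true, ofPred_true, Measure.restrict_apply_univ] at h1
    exact (measure_ball_pos volume (0 : EuclideanSpace ℝ (Fin d)) hR).ne' h1
  · intro w g hw
    obtain ⟨φ, hφ, l1, l2⟩ := hw.exists_approx
    have hlim := tendsto_form (E := E) hs hμ hU.memLp hw.memLp hU.memLp_grad hw.memLp_grad
      (fun _ => hU.memLp) (fun n => (hφ n).memLp) (fun _ => hU.memLp_grad)
      (fun n => (hφ n).memLp_gradient) (tendsto_eLpNorm_const _) l1 (tendsto_eLpNorm_const _) l2
    refine sub_eq_zero.1 (tendsto_nhds_unique hlim (tendsto_const_nhds.congr fun n => ?_))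
    have hn := hφ n
    have h1 := h.integral_fderiv hd (continuous_radialPotential hs μ E) hn.contDiff_one
      hn.hasCompactSupport
    rw [← setIntegral_eq_integral_of_forall_compl_eq_zero (s := ball 0 R) fun x hx => by
      obtain ⟨e1, -, e2⟩ := hn.eq_zero hx
      simp [e1, e2]] at h1
    rw [integral_form_sub_eq hs hμ E hU.memLp hn.memLp hU.memLp_grad hn.memLp_gradient]
    refine h1.symm.trans (integral_congr_ae (.of_forall fun x => ?_))
    simp [inner_gradient_right]
  -- An eigenfunction tested against itself gives E'∫v², which the form bound places above E∫v².
  · rintro E' ⟨v, g, hv, hv0, hE'⟩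
    have h1 := h.le_form hd hs hμ hRL.le hpos hv
    rw [hE' v g hv] at h1
    have hi : Integrable (fun x => v x * v x) (volume.restrict (ball 0 R)) := by
      refine (integrable_inner hv.memLp hv.memLp).congr (.of_forall fun x => by
        simp [pow_two])
    have hp : 0 < ∫ x in ball 0 R, v x * v x := by
      refine lt_of_le_of_ne (MeasureTheory.integral_nonneg fun x => mul_self_nonneg _) fun h0 => hv0 ?_
      have := (integral_eq_zero_iff_of_nonneg (fun x => mul_self_nonneg (v x)) hi).1 h0.symm
      filter_upwards [this] with x hx
      simpa using hx
    exact le_of_mul_le_mul_right h1 hp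

end

/-! ### Existence of the ground state by shooting in the energy. -/

section
open Set Asymptotics Metric
open scoped BoundedContinuousFunction ENNReal

variable {d : ℕ} {L R s μ E : ℝ} {q u F : ℝ → ℝ}

theorem exists_first_zero (hu : Continuous u) (h0 : 0 < u 0)
    (h : ∃ ρ ∈ Icc 0 R, u ρ ≤ 0) :
    ∃ ρ₀ ∈ Ioc 0 R, u ρ₀ = 0 ∧ ∀ ρ, 0 ≤ ρ → ρ < ρ₀ → 0 < u ρ := by
  have hc : IsCompact (Icc 0 R ∩ {ρ | u ρ ≤ 0}) :=
    isCompact_Icc.inter_right (isClosed_le hu continuous_const)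
  obtain ⟨ρ₀, ⟨⟨h1, h2⟩, h3⟩, h4⟩ := hc.exists_isLeast h
  have h3' : u ρ₀ ≤ 0 := h3
  have hne : ρ₀ ≠ 0 := by
    rintro rfl
    linarith
  have hlt : ∀ ρ, 0 ≤ ρ → ρ < ρ₀ → 0 < u ρ := by
    intro ρ hρ hρ0
    by_contra hcon
    exact absurd (h4 ⟨⟨hρ, hρ0.le.trans h2⟩, not_lt.1 hcon⟩) (not_le.2 hρ0)
  have hpos : 0 < ρ₀ := lt_of_le_of_ne h1 hne.symm
  refine ⟨ρ₀, ⟨hpos, h2⟩, le_antisymm h3 ?_, hlt⟩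
  have hmem : ρ₀ ∈ closure (Ico 0 ρ₀) := by
    rw [closure_Ico hpos.ne]
    exact ⟨h1, le_rfl⟩
  exact closure_minimal (fun ρ hρ => (hlt ρ hρ.1 hρ.2).le)
    (isClosed_le continuous_const hu) hmem

namespace IsRadialSolution

/-- Up to a first zero, `pow_mul_F` gives F ≥ 0, so u increases from 1 and cannot reach 0. -/
theorem pos_of_potential_nonneg (h : IsRadialSolution d L q u F) (hd : 1 ≤ d)
    (hqc : Continuous q) (hRL : R < L) (hq : ∀ ρ, 0 ≤ ρ → 0 ≤ q ρ) :
    ∀ ρ ∈ Icc 0 R, 0 < u ρ := by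
  by_contra! hcon
  obtain ⟨ρ₀, ⟨h1, h2⟩, h3, h4⟩ := exists_first_zero h.continuous_u (by simp [h.u_zero]) hcon
  have hF : ∀ r ∈ Ioo 0 ρ₀, 0 ≤ F r := by
    intro r hr
    have h5 := h.pow_mul_F hd hqc hr.1.le (hr.2.trans_le (h2.trans hRL.le))
    refine nonneg_of_mul_nonneg_right (a := r ^ d) ?_ (pow_pos hr.1 d)
    rw [h5]
    refine intervalIntegral.integral_nonneg hr.1.le fun ρ hρ => ?_
    exact mul_nonneg (pow_nonneg hρ.1 _) (mul_nonneg (hq ρ hρ.1)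
      (h4 ρ hρ.1 (hρ.2.trans_lt hr.2)).le)
  have hm : MonotoneOn u (Icc 0 ρ₀) := by
    refine monotoneOn_of_deriv_nonneg (convex_Icc _ _) h.continuous_u.continuousOn ?_ ?_
    all_goals
      intro r hr
      rw [interior_Icc] at hr
      have hd' := h.hasDerivAt_u r (by
        rw [abs_of_pos hr.1]
        exact hr.2.trans_le (h2.trans hRL.le))
    · exact hd'.differentiableAt.differentiableWithinAt
    · rw [hd'.deriv]
      exact mul_nonneg hr.1.le (hF r hr)
  have := hm ⟨le_rfl, h1.le⟩ ⟨h1.le, le_rfl⟩ h1.le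
  rw [h.u_zero, h3] at this
  linarith

end IsRadialSolution

/-- The radial solution on `[0, R + 1]` with parameters `(μ, E)` is positive on `[0, R)` and
vanishes at `R`. -/
def IsGroundPair (d : ℕ) {s R : ℝ} (hs : 0 < s) (hR : 0 ≤ R + 1) (p : ℝ × ℝ) : Prop :=
  (∀ ρ, 0 ≤ ρ → ρ < R → 0 < radialSolution d hs hR p ρ) ∧ radialSolution d hs hR p R = 0

theorem exists_isTestFunction (hR : 0 < R) : ∃ φ : EuclideanSpace ℝ (Fin d) → ℝ,
    IsTestFunction (ball 0 R) φ ∧ 0 < ∫ x, φ x ^ 2 := by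
  let f : ContDiffBump (0 : EuclideanSpace ℝ (Fin d)) := ⟨R / 4, R / 2, by positivity, by linarith⟩
  refine ⟨f, ⟨f.contDiff, f.hasCompactSupport, ?_⟩, ?_⟩
  · rw [f.tsupport_eq]
    exact closedBall_subset_ball (by change R / 2 < R; linarith)
  · have hc : Continuous fun x => f x ^ 2 := f.continuous.pow 2
    refine hc.integral_pos_of_hasCompactSupport_nonneg_nonzero (x := 0)
      (f.hasCompactSupport.comp_left (g := fun y : ℝ => y ^ 2) (by simp))
      (fun x => sq_nonneg _) ?_
    have : f 0 = 1 := f.one_of_mem_closedBall (mem_closedBall_self f.rIn_pos.le)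
    simp [this]

theorem continuous_radialSolution_apply (d : ℕ) (hs : 0 < s) (hL : 0 ≤ L) (ρ : ℝ) :
    Continuous fun p => radialSolution d hs hL p ρ :=
  (BoundedContinuousFunction.evalCLM ℝ ρ).continuous.comp
    (differentiable_radialSolution d hs hL).continuous

/-- The energies for which the radial solution is positive on `[0, R]` are bounded. -/
theorem bddAbove_energies (hd : 1 ≤ d) (hs : 0 < s) (hR : 0 < R) (hL : 0 ≤ R + 1) (μ : ℝ) :
    BddAbove {E | 0 ≤ E ∧ ∀ ρ ∈ Icc 0 R, 0 < radialSolution d hs hL (μ, E) ρ} := by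
  obtain ⟨φ, hφ, hφ0⟩ := exists_isTestFunction (d := d) hR
  have hφ1 := hφ.contDiff_one
  have hc2 : HasCompactSupport fun x => φ x ^ 2 :=
    hφ.hasCompactSupport.comp_left (g := fun y : ℝ => y ^ 2) (by simp)
  have hi2 : Integrable fun x => φ x ^ 2 :=
    (hφ1.continuous.pow 2).integrable_of_hasCompactSupport hc2
  have hi1 : Integrable fun x => ‖gradient φ x‖ ^ 2 + μ * ‖x‖ ^ (2 * s) * φ x ^ 2 := by
    refine Integrable.add ?_ ?_
    · have h1 : HasCompactSupport fun x => ‖gradient φ x‖ ^ 2 :=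
        (HasCompactSupport.gradient hφ.hasCompactSupport).comp_left (g := fun y => ‖y‖ ^ 2)
          (by simp)
      exact ((continuous_gradient hφ1).norm.pow 2).integrable_of_hasCompactSupport h1
    · exact ((continuous_potential hs μ).mul
        (hφ1.continuous.pow 2)).integrable_of_hasCompactSupport hc2.mul_left
  -- The bound is the Rayleigh quotient of one fixed bump function, via Picone.
  refine ⟨(∫ x, (‖gradient φ x‖ ^ 2 + μ * ‖x‖ ^ (2 * s) * φ x ^ 2)) / ∫ x, φ x ^ 2, ?_⟩
  rintro E ⟨-, hE⟩
  have h := (isRadialSolution_radialSolution hd hs hL μ E).integral_nonneg hd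
    (continuous_radialPotential hs μ E) (R := R) (by linarith)
    (fun ρ h0 h1 => hE ρ ⟨h0, h1.le⟩) hφ1 hφ.hasCompactSupport hφ.tsupport_subset
  rw [le_div_iff₀ hφ0, ← integral_const_mul, ← sub_nonneg, ← integral_sub hi1 (hi2.const_mul E)]
  refine h.trans_eq (integral_congr_ae (.of_forall fun x => ?_))
  simp only [radialPotential]
  ring

/-- The energy is the supremum e of those E ≥ 0 whose solution is positive on [0,R]. Positivity on a
compact interval is an open condition, so at e the solution is nonnegative with a zero. An interior
zero would be a double zero, which a Wronskian excludes. -/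
theorem exists_isGroundPair (hd : 1 ≤ d) (hs : 0 < s) (hR : 0 < R) (hL : 0 ≤ R + 1)
    (hμ : 0 ≤ μ) : ∃ E, IsGroundPair d hs hL (μ, E) := by
  set S := {E | 0 ≤ E ∧ ∀ ρ ∈ Icc 0 R, 0 < radialSolution d hs hL (μ, E) ρ} with hS
  have hsol := fun E => isRadialSolution_radialSolution hd hs hL μ E
  have hb : BddAbove S := bddAbove_energies hd hs hR hL μ
  have h0 : (0 : ℝ) ∈ S := by
    refine ⟨le_rfl, (hsol 0).pos_of_potential_nonneg hd (continuous_radialPotential hs μ 0)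
      (by linarith) fun ρ hρ => ?_⟩
    rw [radialPotential, sub_zero]
    positivity
  set e := sSup S with he
  have hle : ∀ E ∈ S, E ≤ e := fun E hE => le_csSup hb hE
  have hcont : ∀ ρ, Continuous fun E => radialSolution d hs hL (μ, E) ρ := fun ρ =>
    (continuous_radialSolution_apply d hs hL ρ).comp (by fun_prop)
  have hnot : e ∉ S := by
    intro heS
    obtain ⟨ρ₁, hρ₁, hmin⟩ := isCompact_Icc.exists_isMinOn (nonempty_Icc.2 hR.le)
      (radialSolution d hs hL (μ, e)).continuous.continuousOn
    have hm := heS.2 ρ₁ hρ₁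
    have hc : Continuous fun E => radialSolution d hs hL (μ, E) :=
      (differentiable_radialSolution d hs hL).continuous.comp (by fun_prop)
    have hev : ∀ᶠ E in 𝓝[>] e, dist (radialSolution d hs hL (μ, E))
        (radialSolution d hs hL (μ, e)) < radialSolution d hs hL (μ, e) ρ₁ :=
      nhdsWithin_le_nhds ((hc.tendsto e).eventually (Metric.ball_mem_nhds _ hm))
    obtain ⟨E, hE1, hE2⟩ := (hev.and self_mem_nhdsWithin).exists
    have hE2' : e < E := hE2
    have hES : E ∈ S := by
      refine ⟨heS.1.trans hE2'.le, fun ρ hρ => ?_⟩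
      have h1 := (BoundedContinuousFunction.dist_coe_le_dist (f := radialSolution d hs hL (μ, E))
        (g := radialSolution d hs hL (μ, e)) ρ).trans_lt hE1
      have h2 : radialSolution d hs hL (μ, e) ρ₁ ≤ radialSolution d hs hL (μ, e) ρ := hmin hρ
      rw [Real.dist_eq, abs_lt] at h1
      linarith [h1.1]
    exact absurd (hle E hES) (not_le.2 hE2')
  have hnn : ∀ ρ ∈ Icc 0 R, 0 ≤ radialSolution d hs hL (μ, e) ρ := by
    intro ρ hρ
    obtain ⟨En, -, hEn, hEnS⟩ := exists_seq_tendsto_sSup ⟨0, h0⟩ hb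
    exact ge_of_tendsto' (((hcont ρ).tendsto e).comp hEn) fun n => ((hEnS n).2 ρ hρ).le
  have hex : ∃ ρ ∈ Icc 0 R, radialSolution d hs hL (μ, e) ρ ≤ 0 := by
    by_contra! hcon
    exact hnot ⟨hle 0 h0, hcon⟩
  obtain ⟨ρ₀, ⟨h1, h2⟩, h3, h4⟩ := exists_first_zero (hsol e).continuous_u
    (by simp [(hsol e).u_zero]) hex
  have h0e : 0 < e := lt_of_le_of_ne (hle 0 h0) fun h => hnot (h ▸ h0)
  -- Compared with the positive solution at E = 0, the Wronskian at ρ₀ is -ρ₀^d u₀(ρ₀) F_e(ρ₀) and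
  -- is strictly positive. So F_e(ρ₀) ≠ 0: the zero is simple.
  have hW := (hsol 0).wronskian (hsol e) hd (continuous_radialPotential hs μ 0)
    (continuous_radialPotential hs μ e) h1.le (by linarith)
  have hWpos : 0 < ∫ ρ in (0 : ℝ)..ρ₀, ρ ^ (d - 1) * ((radialPotential s μ 0 ρ
      - radialPotential s μ e ρ) * (radialSolution d hs hL (μ, 0) ρ
        * radialSolution d hs hL (μ, e) ρ)) := by
    have c1 := (hsol 0).continuous_u
    have c2 := (hsol e).continuous_u
    have c3 := continuous_radialPotential hs μ 0
    have c4 := continuous_radialPotential hs μ e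
    refine intervalIntegral.intervalIntegral_pos_of_pos_on
      (Continuous.intervalIntegrable (by fun_prop) _ _) (fun ρ hρ => ?_) h1
    have e1 : radialPotential s μ 0 ρ - radialPotential s μ e ρ = e := by
      simp [radialPotential]
    rw [e1]
    exact mul_pos (pow_pos hρ.1 _) (mul_pos h0e (mul_pos (h0.2 ρ ⟨hρ.1.le, hρ.2.le.trans h2⟩)
      (h4 ρ hρ.1.le hρ.2)))
  rw [← hW, h3, mul_zero, zero_sub] at hWpos
  have hρR : ρ₀ = R := by
    by_contra hne
    have hlt : ρ₀ < R := lt_of_le_of_ne h2 hne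
    have hmin : IsLocalMin (radialSolution d hs hL (μ, e)) ρ₀ := by
      filter_upwards [Ioo_mem_nhds h1 hlt] with ρ hρ
      rw [h3]
      exact hnn ρ ⟨hρ.1.le, hρ.2.le⟩
    have hz := hmin.hasDerivAt_eq_zero ((hsol e).hasDerivAt_u ρ₀ (by
      rw [abs_of_pos h1]
      linarith))
    have hF : radialSlope d hs hL (μ, e) ρ₀ = 0 := (mul_eq_zero.1 hz).resolve_left h1.ne'
    simp [hF] at hWpos
  rw [hρR] at h3 h4
  exact ⟨e, h4, h3⟩

theorem IsGroundPair.isLeast (hd : 1 ≤ d) {hs : 0 < s} (hR : 0 < R) {hL : 0 ≤ R + 1}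
    (hμ : 0 ≤ μ) (h : IsGroundPair d hs hL (μ, E)) : IsLeast (ballEigenvalues d s μ R) E :=
  (isRadialSolution_radialSolution hd hs hL μ E).isLeast hd hs hμ hR (by linarith) h.1 h.2

theorem isGroundPair_E₁ (hd : 1 ≤ d) (hs : 0 < s) (hR : 0 < R) (hL : 0 ≤ R + 1)
    (hμ : 0 ≤ μ) : IsGroundPair d hs hL (μ, E₁ d s μ R) := by
  obtain ⟨E, hE⟩ := exists_isGroundPair hd hs hR hL hμ
  rwa [E₁, (hE.isLeast hd hR hμ).csInf_eq]

end

/-! ### The Feynman–Hellmann formula and second differentiability. -/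

section
open Set Asymptotics Metric
open scoped BoundedContinuousFunction ENNReal

variable {d : ℕ} {R s μ m E : ℝ}

/-- The functional `f ↦ ∫₀ᴿ k f` on bounded continuous functions. -/
def weightedIntegral (R : ℝ) (k : C(ℝ, ℝ)) : (ℝ →ᵇ ℝ) →L[ℝ] ℝ :=
  LinearMap.mkContinuousOfExistsBound
    { toFun := fun f => ∫ ρ in (0 : ℝ)..R, k ρ * f ρ
      map_add' := fun f g => by
        rw [← intervalIntegral.integral_add
          (Continuous.intervalIntegrable (by fun_prop) _ _)
          (Continuous.intervalIntegrable (by fun_prop) _ _)]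
        simp only [BoundedContinuousFunction.coe_add, Pi.add_apply, mul_add]
      map_smul' := fun c f => by
        rw [RingHom.id_apply, smul_eq_mul, ← intervalIntegral.integral_const_mul]
        congr 1
        ext ρ
        simp only [BoundedContinuousFunction.coe_smul, smul_eq_mul]
        ring }
    (by
      obtain ⟨M, hM⟩ := (isCompact_uIcc (a := 0) (b := R)).exists_bound_of_continuousOn
        k.continuous.continuousOn
      refine ⟨M * |R - 0|, fun f => ?_⟩
      refine (intervalIntegral.norm_integral_le_of_norm_le_const (C := M * ‖f‖)
        fun ρ hρ => ?_).trans_eq (by ring)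
      have h1 := hM ρ (uIoc_subset_uIcc hρ)
      rw [norm_mul]
      exact mul_le_mul h1 (f.norm_coe_le_norm ρ) (norm_nonneg _) ((norm_nonneg _).trans h1))

theorem weightedIntegral_apply (R : ℝ) (k : C(ℝ, ℝ)) (f : ℝ →ᵇ ℝ) :
    weightedIntegral R k f = ∫ ρ in (0 : ℝ)..R, k ρ * f ρ := rfl

theorem mul_weightedIntegral_sub (R : ℝ) (k l : C(ℝ, ℝ)) (f : ℝ →ᵇ ℝ) (a b : ℝ) :
    a * weightedIntegral R k f - b * weightedIntegral R l f
      = ∫ ρ in (0 : ℝ)..R, (a * k ρ - b * l ρ) * f ρ := by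
  rw [weightedIntegral_apply, weightedIntegral_apply, ← intervalIntegral.integral_const_mul,
    ← intervalIntegral.integral_const_mul, ← intervalIntegral.integral_sub
    (Continuous.intervalIntegrable (by fun_prop) _ _)
    (Continuous.intervalIntegrable (by fun_prop) _ _)]
  congr 1
  ext ρ
  ring

/-- The radial volume density. -/
def volWeight (d : ℕ) : C(ℝ, ℝ) := ⟨fun ρ => ρ ^ (d - 1), continuous_pow _⟩

/-- The density `ρ^{d-1} ρ^{2s}`. -/
def momentWeight (d : ℕ) (hs : 0 < s) : C(ℝ, ℝ) := volWeight d * powMap hs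

theorem volWeight_apply (d : ℕ) (ρ : ℝ) : volWeight d ρ = ρ ^ (d - 1) := rfl

theorem momentWeight_apply (d : ℕ) (hs : 0 < s) (ρ : ℝ) :
    momentWeight d hs ρ = ρ ^ (d - 1) * ρ ^ (2 * s) := rfl

theorem weightedIntegral_pos (hR : 0 < R) {k : C(ℝ, ℝ)} {f : ℝ →ᵇ ℝ}
    (hk : ∀ ρ ∈ Ioo 0 R, 0 < k ρ) (hf : ∀ ρ ∈ Ioo 0 R, 0 < f ρ) : 0 < weightedIntegral R k f :=
  intervalIntegral.intervalIntegral_pos_of_pos_on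
    ((k.continuous.mul f.continuous).intervalIntegrable _ _)
    (fun ρ hρ => mul_pos (hk ρ hρ) (hf ρ hρ)) hR

theorem IsGroundPair.pos {hs : 0 < s} {hL : 0 ≤ R + 1} {p : ℝ × ℝ}
    (h : IsGroundPair d hs hL p) : ∀ ρ ∈ Ioo 0 R, 0 < radialSolution d hs hL p ρ :=
  fun ρ hρ => h.1 ρ hρ.1.le hρ.2

theorem IsGroundPair.volume_pos (hR : 0 < R) {hs : 0 < s} {hL : 0 ≤ R + 1} {p p' : ℝ × ℝ}
    (h : IsGroundPair d hs hL p) (h' : IsGroundPair d hs hL p') :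
    0 < weightedIntegral R (volWeight d) (radialSolution d hs hL p * radialSolution d hs hL p') :=
  weightedIntegral_pos hR (fun _ hρ => pow_pos hρ.1 _) fun ρ hρ => mul_pos (h.pos ρ hρ) (h'.pos ρ hρ)

theorem IsGroundPair.moment_pos (hR : 0 < R) {hs : 0 < s} {hL : 0 ≤ R + 1} {p p' : ℝ × ℝ}
    (h : IsGroundPair d hs hL p) (h' : IsGroundPair d hs hL p') :
    0 < weightedIntegral R (momentWeight d hs)
      (radialSolution d hs hL p * radialSolution d hs hL p') :=
  weightedIntegral_pos hR (fun _ hρ => mul_pos (pow_pos hρ.1 _) (Real.rpow_pos_of_pos hρ.1 _))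
    fun ρ hρ => mul_pos (h.pos ρ hρ) (h'.pos ρ hρ)

theorem IsGroundPair.moment_le (hR : 0 < R) {hs : 0 < s} {hL : 0 ≤ R + 1} {p p' : ℝ × ℝ}
    (h : IsGroundPair d hs hL p) (h' : IsGroundPair d hs hL p') :
    weightedIntegral R (momentWeight d hs)
        (radialSolution d hs hL p * radialSolution d hs hL p')
      < R ^ (2 * s) * weightedIntegral R (volWeight d)
        (radialSolution d hs hL p * radialSolution d hs hL p') := by
  set f := radialSolution d hs hL p * radialSolution d hs hL p' with hf
  have h0 := mul_weightedIntegral_sub R (volWeight d) (momentWeight d hs) f (R ^ (2 * s)) 1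
  rw [one_mul] at h0
  rw [← sub_pos, h0]
  refine intervalIntegral.intervalIntegral_pos_of_pos_on
    (Continuous.intervalIntegrable (by fun_prop) _ _) (fun ρ hρ => ?_) hR
  have h1 : ρ ^ (2 * s) < R ^ (2 * s) := Real.rpow_lt_rpow hρ.1.le hρ.2 (by positivity)
  have h2 : 0 < f ρ := mul_pos (h.pos ρ hρ) (h'.pos ρ hρ)
  have h3 : 0 < ρ ^ (d - 1) := pow_pos hρ.1 _
  rw [volWeight_apply, momentWeight_apply]
  have := mul_pos (mul_pos h3 h2) (sub_pos.2 h1)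
  linarith

/-- The relation between two ground states of different coupling constants. -/
theorem IsGroundPair.sub_mul_eq (hd : 1 ≤ d) (hR : 0 < R) {hs : 0 < s} {hL : 0 ≤ R + 1}
    {μ₁ μ₂ E₁ E₂ : ℝ} (h₁ : IsGroundPair d hs hL (μ₁, E₁)) (h₂ : IsGroundPair d hs hL (μ₂, E₂)) :
    (E₁ - E₂) * weightedIntegral R (volWeight d)
        (radialSolution d hs hL (μ₁, E₁) * radialSolution d hs hL (μ₂, E₂))
      = (μ₁ - μ₂) * weightedIntegral R (momentWeight d hs)
        (radialSolution d hs hL (μ₁, E₁) * radialSolution d hs hL (μ₂, E₂)) := by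
  -- Both solutions vanish at R, so the boundary term drops out.
  have hW := (isRadialSolution_radialSolution hd hs hL μ₁ E₁).wronskian
    (isRadialSolution_radialSolution hd hs hL μ₂ E₂) hd (continuous_radialPotential hs _ _)
    (continuous_radialPotential hs _ _) hR.le (by linarith)
  rw [h₁.2, h₂.2, mul_zero, zero_mul, sub_zero, mul_zero] at hW
  set f := radialSolution d hs hL (μ₁, E₁) * radialSolution d hs hL (μ₂, E₂) with hf
  rw [eq_comm, ← sub_eq_zero, mul_weightedIntegral_sub]
  refine Eq.trans ?_ hW.symm
  refine intervalIntegral.integral_congr fun ρ _ => ?_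
  simp only [volWeight_apply, momentWeight_apply, radialPotential, hf,
    BoundedContinuousFunction.coe_mul, Pi.mul_apply]
  ring

/-- The ground state of the ball for the coupling constant `μ`. -/
def groundState (d : ℕ) (hs : 0 < s) (hL : 0 ≤ R + 1) (μ : ℝ) : ℝ →ᵇ ℝ :=
  radialSolution d hs hL (μ, E₁ d s μ R)

/-- The mean of `ρ^{2s}` in the ground state. -/
def groundMoment (d : ℕ) (hs : 0 < s) (hL : 0 ≤ R + 1) (μ : ℝ) : ℝ :=
  weightedIntegral R (momentWeight d hs) (groundState d hs hL μ * groundState d hs hL μ)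
    / weightedIntegral R (volWeight d) (groundState d hs hL μ * groundState d hs hL μ)

/-- E₁ is Lipschitz: the ratio of the two integrals in `IsGroundPair.sub_mul_eq` lies between 0 and
R^{2s}. -/
theorem continuousAt_E₁ (hd : 1 ≤ d) (hs : 0 < s) (hR : 0 < R) (hL : 0 ≤ R + 1) (hμ : 0 < μ) :
    ContinuousAt (fun m => E₁ d s m R) μ := by
  have hlip : ∀ m, 0 < m → |E₁ d s m R - E₁ d s μ R| ≤ R ^ (2 * s) * |m - μ| := by
    intro m hm
    have g1 := isGroundPair_E₁ hd hs hR hL hm.le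
    have g2 := isGroundPair_E₁ hd hs hR hL hμ.le
    have h1 := congrArg abs (g1.sub_mul_eq hd hR g2)
    have h2 := g1.volume_pos hR g2
    have h3 := g1.moment_pos hR g2
    have h4 := g1.moment_le hR g2
    rw [abs_mul, abs_mul, abs_of_pos h2, abs_of_pos h3] at h1
    refine le_of_mul_le_mul_right ?_ h2
    rw [h1]
    have := mul_le_mul_of_nonneg_left h4.le (abs_nonneg (m - μ))
    linarith
  rw [ContinuousAt, tendsto_iff_dist_tendsto_zero]
  have hlim : Tendsto (fun m => R ^ (2 * s) * |m - μ|) (𝓝 μ) (𝓝 0) := by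
    have : Continuous fun m => R ^ (2 * s) * |m - μ| := by fun_prop
    simpa using this.tendsto μ
  refine squeeze_zero' (.of_forall fun _ => dist_nonneg) ?_ hlim
  filter_upwards [lt_mem_nhds hμ] with m hm
  exact hlip m hm

/-- The difference quotient equals the mean of ρ^{2s} against u_m u_μ exactly; continuity of E₁,
hence of the ground state, lets m tend to μ. -/
theorem hasDerivAt_E₁ (hd : 1 ≤ d) (hs : 0 < s) (hR : 0 < R) (hL : 0 ≤ R + 1) (hμ : 0 < μ) :
    HasDerivAt (fun m => E₁ d s m R) (groundMoment d hs hL μ) μ := by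
  have gμ := isGroundPair_E₁ hd hs hR hL hμ.le
  have hc : ContinuousAt (groundState (R := R) d hs hL) μ :=
    (differentiable_radialSolution d hs hL).continuous.continuousAt.comp
      (continuousAt_id.prodMk (continuousAt_E₁ hd hs hR hL hμ))
  have hc2 : ContinuousAt (fun m => groundState (R := R) d hs hL m * groundState d hs hL μ) μ :=
    hc.mul continuousAt_const
  have hlim : ContinuousAt (fun m => weightedIntegral R (momentWeight d hs)
      (groundState d hs hL m * groundState d hs hL μ) / weightedIntegral R (volWeight d)
      (groundState d hs hL m * groundState d hs hL μ)) μ :=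
    ((weightedIntegral R (momentWeight d hs)).continuous.continuousAt.comp hc2).div
      ((weightedIntegral R (volWeight d)).continuous.continuousAt.comp hc2)
      (gμ.volume_pos hR gμ).ne'
  rw [hasDerivAt_iff_tendsto_slope]
  refine (hlim.tendsto.mono_left nhdsWithin_le_nhds).congr' ?_
  filter_upwards [nhdsWithin_le_nhds (lt_mem_nhds hμ), self_mem_nhdsWithin] with m hm hne
  have gm := isGroundPair_E₁ hd hs hR hL (le_of_lt hm)
  have h1 := gm.sub_mul_eq hd hR gμ
  have h2 := gm.volume_pos hR gμ
  have h3 : m - μ ≠ 0 := sub_ne_zero.2 hne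
  rw [slope_def_field]
  refine (div_eq_div_iff h2.ne' h3).2 ?_
  rw [h1]
  exact mul_comm _ _

/-- Now that E₁ is differentiable, so is the ground state as a function of μ, and the moment is a
quotient of bounded functionals of its square. -/
theorem differentiableAt_groundMoment (hd : 1 ≤ d) (hs : 0 < s) (hR : 0 < R) (hL : 0 ≤ R + 1)
    (hμ : 0 < μ) : DifferentiableAt ℝ (groundMoment (R := R) d hs hL) μ := by
  have gμ := isGroundPair_E₁ hd hs hR hL hμ.le
  have h1 : DifferentiableAt ℝ (groundState (R := R) d hs hL) μ :=
    (differentiable_radialSolution d hs hL).differentiableAt.comp μ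
      (differentiableAt_id.prodMk (hasDerivAt_E₁ hd hs hR hL hμ).differentiableAt)
  have h2 : DifferentiableAt ℝ (fun m => groundState (R := R) d hs hL m * groundState d hs hL m) μ :=
    h1.mul h1
  exact ((weightedIntegral R (momentWeight d hs)).differentiableAt.comp μ h2).div
    ((weightedIntegral R (volWeight d)).differentiableAt.comp μ h2) (gμ.volume_pos hR gμ).ne'

end

/-! ### Comparison of moments by dilation and monotone ratios. -/

section
open Set Asymptotics Metric
open scoped BoundedContinuousFunction ENNReal

variable {d : ℕ} {R L s μ E : ℝ} {u v F G q : ℝ → ℝ}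

/-- Moments increase under a reweighting by a monotone likelihood ratio. -/
theorem integral_sub_mul_nonneg (hs : 0 < s) (hR : 0 < R) {P : ℝ} (hP0 : 0 ≤ P)
    (hPR : P < R ^ (2 * s)) (hu : Continuous u) (hv : Continuous v)
    (hupos : ∀ ρ, 0 ≤ ρ → ρ < R → 0 < u ρ) (hvpos : ∀ ρ, 0 ≤ ρ → ρ < R → 0 ≤ v ρ)
    (hmono : MonotoneOn (fun ρ => v ρ / u ρ) (Ico 0 R))
    (hmean : ∫ ρ in (0 : ℝ)..R, ρ ^ (d - 1) * ((ρ ^ (2 * s) - P) * u ρ ^ 2) = 0) :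
    0 ≤ ∫ ρ in (0 : ℝ)..R, ρ ^ (d - 1) * ((ρ ^ (2 * s) - P) * v ρ ^ 2) := by
  have hs2 : 0 < 2 * s := by positivity
  have hpow := Real.continuous_rpow_const hs2.le
  -- y is the radius at which ρ^{2s} - P changes sign. By monotonicity (v/u)² - Q² changes sign
  -- there too, so the product of the two is nonnegative.
  set y := P ^ (2 * s)⁻¹ with hy
  have hy0 : 0 ≤ y := Real.rpow_nonneg hP0 _
  have hyP : y ^ (2 * s) = P := Real.rpow_inv_rpow hP0 hs2.ne'
  have hyR : y < R := by
    rw [← hyP] at hPR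
    exact (Real.rpow_lt_rpow_iff hy0 hR.le hs2).1 hPR
  set Q := v y / u y with hQ
  have hQ0 : 0 ≤ Q := div_nonneg (hvpos y hy0 hyR) (hupos y hy0 hyR).le
  have key : ∀ ρ ∈ Ioo 0 R, Q ^ 2 * (ρ ^ (d - 1) * ((ρ ^ (2 * s) - P) * u ρ ^ 2))
      ≤ ρ ^ (d - 1) * ((ρ ^ (2 * s) - P) * v ρ ^ 2) := by
    intro ρ hρ
    have hu0 := hupos ρ hρ.1.le hρ.2
    set r := v ρ / u ρ with hr
    have hr0 : 0 ≤ r := div_nonneg (hvpos ρ hρ.1.le hρ.2) hu0.le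
    have hvr : v ρ = r * u ρ := by
      rw [hr]
      field_simp
    have h1 : 0 ≤ (ρ ^ (2 * s) - P) * (r ^ 2 - Q ^ 2) := by
      rcases le_total y ρ with h | h
      · refine mul_nonneg ?_ ?_
        · rw [sub_nonneg, ← hyP]
          exact Real.rpow_le_rpow hy0 h hs2.le
        · rw [sub_nonneg]
          exact pow_le_pow_left₀ hQ0 (hmono ⟨hy0, hyR⟩ ⟨hρ.1.le, hρ.2⟩ h) 2
      · refine mul_nonneg_of_nonpos_of_nonpos ?_ ?_
        · rw [sub_nonpos, ← hyP]
          exact Real.rpow_le_rpow hρ.1.le h hs2.le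
        · rw [sub_nonpos]
          exact pow_le_pow_left₀ hr0 (hmono ⟨hρ.1.le, hρ.2⟩ ⟨hy0, hyR⟩ h) 2
    rw [hvr]
    have h2 := mul_nonneg (mul_nonneg (pow_nonneg hρ.1.le (d - 1)) (sq_nonneg (u ρ))) h1
    linarith
  have h0 : ∫ ρ in (0 : ℝ)..R, Q ^ 2 * (ρ ^ (d - 1) * ((ρ ^ (2 * s) - P) * u ρ ^ 2)) = 0 := by
    rw [intervalIntegral.integral_const_mul, hmean, mul_zero]
  refine h0.symm.le.trans ?_
  have c1 : Continuous fun ρ : ℝ => Q ^ 2 * (ρ ^ (d - 1) * ((ρ ^ (2 * s) - P) * u ρ ^ 2)) := by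
    fun_prop
  have c2 : Continuous fun ρ : ℝ => ρ ^ (d - 1) * ((ρ ^ (2 * s) - P) * v ρ ^ 2) := by fun_prop
  exact intervalIntegral.integral_mono_on_of_le_Ioo (μ := volume) hR.le
    (c1.intervalIntegrable _ _) (c2.intervalIntegrable _ _)
    key

/-- Two radial solutions with potentials differing by a constant: if the first vanishes at `R`
and the second is positive on `[0, R]`, their ratio is monotone. -/
theorem IsRadialSolution.monotoneOn_div {p : ℝ → ℝ} {κ : ℝ} (hu : IsRadialSolution d L p u F)
    (hv : IsRadialSolution d L q v G) (hd : 1 ≤ d) (hp : Continuous p) (hq : Continuous q)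
    (hpq : ∀ ρ, 0 ≤ ρ → p ρ - q ρ = κ) (hR : 0 < R) (hRL : R < L)
    (hupos : ∀ ρ, 0 ≤ ρ → ρ < R → 0 < u ρ) (huR : u R = 0)
    (hvpos : ∀ ρ, 0 ≤ ρ → ρ ≤ R → 0 < v ρ) :
    MonotoneOn (fun ρ => v ρ / u ρ) (Ico 0 R) := by
  have cu := hu.continuous_u
  have cv := hv.continuous_u
  have hW : ∀ r, 0 ≤ r → r < L → r ^ d * (F r * v r - u r * G r)
      = κ * ∫ ρ in (0 : ℝ)..r, ρ ^ (d - 1) * (u ρ * v ρ) := by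
    intro r h0 hrL
    rw [hu.wronskian hv hd hp hq h0 hrL, ← intervalIntegral.integral_const_mul]
    refine intervalIntegral.integral_congr fun ρ hρ => ?_
    rw [uIcc_of_le h0] at hρ
    simp only [hpq ρ hρ.1]
    ring
  have hIpos : ∀ r, 0 < r → r ≤ R → 0 < ∫ ρ in (0 : ℝ)..r, ρ ^ (d - 1) * (u ρ * v ρ) :=
    fun r h0 hrR => intervalIntegral.intervalIntegral_pos_of_pos_on
      (Continuous.intervalIntegrable (by fun_prop) _ _)
      (fun ρ hρ => mul_pos (pow_pos hρ.1 _) (mul_pos (hupos ρ hρ.1.le (hρ.2.trans_le hrR))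
        (hvpos ρ hρ.1.le (hρ.2.le.trans hrR)))) h0
  have hFR : F R ≤ 0 := by
    have h1 := hu.hasDerivAt_u R (by rwa [abs_of_pos hR])
    have h2 : R * F R ≤ 0 := by
      rw [hasDerivAt_iff_tendsto_slope] at h1
      have h3 := h1.mono_left (nhdsWithin_mono R fun x (hx : x ∈ Iio R) => ne_of_lt hx)
      refine le_of_tendsto h3 ?_
      filter_upwards [Ioo_mem_nhdsLT hR] with x hx
      rw [slope_def_field, huR]
      exact div_nonpos_of_nonneg_of_nonpos (by linarith [hupos x hx.1.le hx.2])
        (by linarith [hx.2])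
    exact nonpos_of_mul_nonpos_right h2 hR
  -- The sign of κ is read off at R, where the Wronskian reduces to R^d F(R) v(R) ≤ 0; no direct
  -- comparison of energies is needed.
  have hκ : κ ≤ 0 := by
    have h1 := hW R hR.le hRL
    rw [huR, zero_mul, sub_zero] at h1
    by_contra! hcon
    have h2 := mul_pos hcon (hIpos R hR le_rfl)
    rw [← h1] at h2
    have h3 := mul_nonpos_of_nonneg_of_nonpos (pow_nonneg hR.le d)
      (mul_nonpos_of_nonpos_of_nonneg hFR (hvpos R hR.le le_rfl).le)
    linarith
  refine monotoneOn_of_deriv_nonneg (convex_Ico _ _)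
    (cv.continuousOn.div cu.continuousOn fun ρ hρ => (hupos ρ hρ.1 hρ.2).ne') ?_ ?_
  all_goals
    intro r hr
    rw [interior_Ico] at hr
    have hrL : |r| < L := by
      rw [abs_of_pos hr.1]
      exact hr.2.trans hRL
    have hur := hupos r hr.1.le hr.2
    have hder := (hv.hasDerivAt_u r hrL).fun_div (hu.hasDerivAt_u r hrL) hur.ne'
  · exact hder.differentiableAt.differentiableWithinAt
  · rw [hder.deriv]
    refine div_nonneg ?_ (sq_nonneg _)
    -- The numerator of (v/u)' is r(Gu - vF), minus a positive multiple of the Wronskian, which has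
    -- the sign of κ.
    have h1 := hW r hr.1.le (hr.2.trans hRL)
    have h2 := mul_nonpos_of_nonpos_of_nonneg hκ (hIpos r hr.1 hr.2.le).le
    rw [← h1] at h2
    have h3 := nonpos_of_mul_nonpos_right h2 (pow_pos hr.1 d)
    have h4 := mul_nonneg hr.1.le (neg_nonneg.2 h3)
    linarith

/-- The ground state moments at two coupling constants, compared after rescaling. -/
theorem mul_groundMoment_le (hd : 1 ≤ d) (hs : 0 < s) (hR : 0 < R) (hL : 0 ≤ R + 1) {μ₁ μ₂ c : ℝ}
    (hμ₁ : 0 < μ₁) (hμ₂ : 0 < μ₂) (hc0 : 0 < c) (hc1 : c < 1) (hc : c ^ 2 * c ^ (2 * s) * μ₂ = μ₁) :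
    c ^ (2 * s) * groundMoment (R := R) d hs hL μ₁ ≤ groundMoment (R := R) d hs hL μ₂ := by
  have g1 := isGroundPair_E₁ hd hs hR hL hμ₁.le
  have g2 := isGroundPair_E₁ hd hs hR hL hμ₂.le
  have s1 := isRadialSolution_radialSolution hd hs hL μ₁ (E₁ d s μ₁ R)
  have s2 := (isRadialSolution_radialSolution hd hs hL μ₂ (E₁ d s μ₂ R)).comp_mul hc0
  have s2' := s2.mono (L' := R + 1) (by
    rw [le_div_iff₀ hc0]
    exact mul_le_of_le_one_right hL hc1.le)
  set u := groundState d hs hL μ₁ with hu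
  set w := groundState d hs hL μ₂ with hw
  have hpow := Real.continuous_rpow_const (q := 2 * s) (by positivity)
  set P := groundMoment d hs hL μ₁ with hP
  have hB1 := g1.volume_pos hR g1
  have hB2 := g2.volume_pos hR g2
  have hP0 : 0 ≤ P := (div_pos (g1.moment_pos hR g1) hB1).le
  have hPR : P < R ^ (2 * s) := (div_lt_iff₀ hB1).2 (g1.moment_le hR g1)
  -- By `hc` the dilated potential carries the same term μ₁ρ^{2s}, so only the energies differ.
  -- Since cR < R, the dilated state is positive on all of [0,R].
  have hmono : MonotoneOn (fun ρ => w (c * ρ) / u ρ) (Ico 0 R) := by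
    refine s1.monotoneOn_div (κ := c ^ 2 * E₁ d s μ₂ R - E₁ d s μ₁ R) s2' hd
      (continuous_radialPotential hs _ _) ?_ ?_ hR (by linarith) g1.1 g1.2 ?_
    · exact continuous_const.mul ((continuous_radialPotential hs _ _).comp
        (continuous_const.mul continuous_id))
    · intro ρ hρ
      rw [radialPotential, radialPotential, Real.mul_rpow hc0.le hρ, ← hc]
      ring
    · intro ρ h0 h1
      refine g2.1 _ (by positivity) ?_
      nlinarith
  have hmean : ∫ ρ in (0 : ℝ)..R, ρ ^ (d - 1) * ((ρ ^ (2 * s) - P) * u ρ ^ 2) = 0 := by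
    have h1 := mul_weightedIntegral_sub R (momentWeight d hs) (volWeight d) (u * u) 1 P
    have h2 : P * weightedIntegral R (volWeight d) (u * u)
        = weightedIntegral R (momentWeight d hs) (u * u) := div_mul_cancel₀ _ hB1.ne'
    rw [one_mul, h2, sub_self] at h1
    refine Eq.trans ?_ h1.symm
    refine intervalIntegral.integral_congr fun ρ _ => ?_
    simp only [volWeight_apply, momentWeight_apply, BoundedContinuousFunction.coe_mul,
      Pi.mul_apply]
    ring
  have hcomp := integral_sub_mul_nonneg (d := d) (v := fun ρ => w (c * ρ)) hs hR hP0 hPR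
    u.continuous (w.continuous.comp (continuous_const.mul continuous_id)) g1.1
    (fun ρ h0 h1 => (g2.1 _ (by positivity) (by nlinarith)).le) hmono hmean
  -- In the original variable, [0,R] becomes [0,cR] and the threshold P becomes c^{2s}P.
  have hsub : ∫ ρ in (0 : ℝ)..(c * R), ρ ^ (d - 1) * ((ρ ^ (2 * s) - c ^ (2 * s) * P) * w ρ ^ 2)
      = c * (c ^ (d - 1) * c ^ (2 * s)) *
        ∫ ρ in (0 : ℝ)..R, ρ ^ (d - 1) * ((ρ ^ (2 * s) - P) * w (c * ρ) ^ 2) := by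
    have h1 := intervalIntegral.mul_integral_comp_mul_left (a := 0) (b := R)
      (f := fun ρ => ρ ^ (d - 1) * ((ρ ^ (2 * s) - c ^ (2 * s) * P) * w ρ ^ 2)) c
    rw [mul_zero] at h1
    rw [← h1, mul_assoc c]
    congr 1
    rw [← intervalIntegral.integral_const_mul]
    refine intervalIntegral.integral_congr fun ρ hρ => ?_
    rw [uIcc_of_le hR.le] at hρ
    simp only [Real.mul_rpow hc0.le hρ.1, mul_pow]
    ring
  have hcont : Continuous fun ρ : ℝ => ρ ^ (d - 1) * ((ρ ^ (2 * s) - c ^ (2 * s) * P) * w ρ ^ 2) := by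
    fun_prop
  have hcR : c * R ≤ R := mul_le_of_le_one_left hR.le hc1.le
  -- For ρ ≥ cR one has ρ^{2s} ≥ c^{2s}R^{2s} ≥ c^{2s}P, so the remaining part of w only raises the
  -- mean.
  have htail : 0 ≤ ∫ ρ in (c * R)..R,
      ρ ^ (d - 1) * ((ρ ^ (2 * s) - c ^ (2 * s) * P) * w ρ ^ 2) := by
    refine intervalIntegral.integral_nonneg hcR fun ρ hρ => ?_
    have h0 : 0 ≤ ρ := (by positivity : 0 ≤ c * R).trans hρ.1
    refine mul_nonneg (pow_nonneg h0 _) (mul_nonneg ?_ (sq_nonneg _))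
    rw [sub_nonneg]
    calc c ^ (2 * s) * P ≤ c ^ (2 * s) * R ^ (2 * s) := by gcongr
      _ = (c * R) ^ (2 * s) := (Real.mul_rpow hc0.le hR.le).symm
      _ ≤ ρ ^ (2 * s) := Real.rpow_le_rpow (by positivity) hρ.1 (by positivity)
  have htot : 0 ≤ ∫ ρ in (0 : ℝ)..R,
      ρ ^ (d - 1) * ((ρ ^ (2 * s) - c ^ (2 * s) * P) * w ρ ^ 2) := by
    rw [← intervalIntegral.integral_add_adjacent_intervals (b := c * R)
      (hcont.intervalIntegrable _ _) (hcont.intervalIntegrable _ _), hsub]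
    exact add_nonneg (mul_nonneg (by positivity) hcomp) htail
  have hfin := mul_weightedIntegral_sub R (momentWeight d hs) (volWeight d) (w * w) 1
    (c ^ (2 * s) * P)
  refine (le_div_iff₀ hB2).2 ?_
  rw [← sub_nonneg]
  rw [one_mul] at hfin
  refine htot.trans_eq (Eq.trans ?_ hfin.symm)
  refine intervalIntegral.integral_congr fun ρ _ => ?_
  simp only [volWeight_apply, momentWeight_apply, BoundedContinuousFunction.coe_mul,
    Pi.mul_apply]
  ring

theorem monotoneOn_rpow_mul_groundMoment (hd : 1 ≤ d) (hs : 0 < s) (hR : 0 < R) (hL : 0 ≤ R + 1) :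
    MonotoneOn (fun m => m ^ (s / (1 + s)) * groundMoment (R := R) d hs hL m) (Ioi 0) := by
  intro a ha b hb hab
  have ha' : 0 < a := ha
  have hb' : 0 < b := hb
  rcases hab.eq_or_lt with rfl | hlt
  · exact le_rfl
  have hab0 : 0 < a / b := div_pos ha' hb'
  -- c solves c^{2+2s} = a/b; then c^{2s} = (a/b)^{s/(1+s)}, which is the origin of the exponent.
  set c := (a / b) ^ (1 / (2 * (1 + s))) with hc
  have hc0 : 0 < c := Real.rpow_pos_of_pos hab0 _
  have hc1 : c < 1 := Real.rpow_lt_one hab0.le ((div_lt_one hb').2 hlt) (by positivity)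
  have hs1 : (1 + s) ≠ 0 := by positivity
  have e1 : c ^ (2 * s) = (a / b) ^ (s / (1 + s)) := by
    rw [hc, ← Real.rpow_mul hab0.le]
    congr 1
    field_simp
  have e2 : c ^ 2 * c ^ (2 * s) = a / b := by
    rw [← Real.rpow_natCast c 2, ← Real.rpow_add hc0, hc, ← Real.rpow_mul hab0.le]
    convert Real.rpow_one (a / b) using 2
    push_cast
    field_simp
  have h := mul_groundMoment_le hd hs hR hL ha' hb' hc0 hc1 (by rw [e2]; field_simp)
  rw [e1, Real.div_rpow ha'.le hb'.le, div_mul_eq_mul_div,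
    div_le_iff₀ (Real.rpow_pos_of_pos hb' _)] at h
  simp only
  linarith

end

end Schrodinger

end

/-! ### From the monotonicity to the differential inequality. -/

theorem mainTheorem2 (d₁ : ℕ) (hd₁ : 1 ≤ d₁) (s : ℝ) (hs : 0 < s)
    (R : ℝ) (hR : 0 < R) (μ : ℝ) (hμ : 0 < μ) :
    -- the infimum defining `E₁(μ,R)` is attained: it is the least eigenvalue
    IsLeast (Schrodinger.ballEigenvalues d₁ s μ R) (Schrodinger.E₁ d₁ s μ R) ∧
    -- `E₁(·,R)` is twice differentiable at `μ`
    DifferentiableAt ℝ (fun m => Schrodinger.E₁ d₁ s m R) μ ∧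
    DifferentiableAt ℝ (deriv fun m => Schrodinger.E₁ d₁ s m R) μ ∧
    0 ≤ s * deriv (fun m => Schrodinger.E₁ d₁ s m R) μ
      + μ * (1 + s) * deriv (deriv fun m => Schrodinger.E₁ d₁ s m R) μ := by
  have hL : 0 ≤ R + 1 := by linarith
  have hder := Schrodinger.hasDerivAt_E₁ hd₁ hs hR hL hμ
  have hH := Schrodinger.differentiableAt_groundMoment hd₁ hs hR hL hμ
  have hev : (deriv fun m => Schrodinger.E₁ d₁ s m R)
      =ᶠ[𝓝 μ] Schrodinger.groundMoment (R := R) d₁ hs hL := by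
    filter_upwards [lt_mem_nhds hμ] with m hm
    exact (Schrodinger.hasDerivAt_E₁ hd₁ hs hR hL hm).deriv
  refine ⟨(Schrodinger.isGroundPair_E₁ hd₁ hs hR hL hμ.le).isLeast hd₁ hR hμ.le,
    hder.differentiableAt, hH.congr_of_eventuallyEq hev, ?_⟩
  rw [hev.deriv_eq, hder.deriv]
  have hM := (Real.hasDerivAt_rpow_const (p := s / (1 + s)) (.inl hμ.ne')).mul hH.hasDerivAt
  have hmono := Schrodinger.monotoneOn_rpow_mul_groundMoment hd₁ hs hR hL
  have hnn := hmono.derivWithin_nonneg (x := μ)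
  rw [derivWithin_of_mem_nhds (Ioi_mem_nhds hμ)] at hnn
  erw [hM.deriv] at hnn
  -- Multiplying (μ^{s/(1+s)} H)' ≥ 0 by this factor gives sH + (1+s)μH' ≥ 0.
  have hpos : 0 < (1 + s) * μ ^ (1 - s / (1 + s)) :=
    mul_pos (by positivity) (Real.rpow_pos_of_pos hμ _)
  have e1 : μ ^ (s / (1 + s) - 1) * μ ^ (1 - s / (1 + s)) = 1 := by
    rw [← Real.rpow_add hμ]
    simp
  have e2 : μ ^ (s / (1 + s)) * μ ^ (1 - s / (1 + s)) = μ := by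
    rw [← Real.rpow_add hμ]
    simp
  have hs1 : (1 + s) * (s / (1 + s)) = s := by field_simp
  have h := mul_nonneg hpos.le hnn
  refine h.trans_eq ?_
  set H := Schrodinger.groundMoment (R := R) d₁ hs hL μ
  set H' := deriv (Schrodinger.groundMoment (R := R) d₁ hs hL) μ
  calc (1 + s) * μ ^ (1 - s / (1 + s))
        * (s / (1 + s) * μ ^ (s / (1 + s) - 1) * H + μ ^ (s / (1 + s)) * H')
      = ((1 + s) * (s / (1 + s))) * (μ ^ (s / (1 + s) - 1) * μ ^ (1 - s / (1 + s))) * H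
        + (1 + s) * (μ ^ (s / (1 + s)) * μ ^ (1 - s / (1 + s))) * H' := by ring
    _ = _ := by
      rw [hs1, e1, e2]
      ring
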